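/- **Corollary 3.5 (Homotopy Uniqueness).** Let $n\ge 0$. *The category $\mathrm{Cob}(n)$.* Let $\alpha$ be a formal variable. Objects of $\mathrm{Cob}(n)$ are formally $q$-graded Temperley–Lieb diagrams $q^iD$ ($i\in\mathbb Z$), where $D$ is a planar diagram (possibly with closed circles) in a rectangle with $n$ boundary points at the bottom and $n$ at the top. Morphisms between such diagrams are $\mathbb Z[\alpha]$-linear combinations of dotted cobordisms embedded in the thickened rectangle, considered up to isotopy relative to the boundary and modulo the local relations: a sphere with $0,1,2,3$ dots equals $0,1,0,\alpha$ respectively, and (neck cutting) a tube around a disc equals the sum of the two ways of cutting it into two discs, one of which carries a dot. A cobordism $S:q^iA\to q^jB$ with $d$ dots and underlying surface $|S|$ has degree $\chi(|S|)-n-2d+(j-i)$, and $\alpha$ has degree $-4$; the morphisms $q^iA\to q^jB$ of $\mathrm{Cob}(n)$ are the combinations of degree $0$. Gluing diagrams vertically along $n$ boundary points, and cobordisms along $n$ boundary intervals, defines $\otimes$. Write $1$ for the identity diagram ($n$ vertical strands, in $q$-degree $0$), and $e_i$, $0<i<n$, for the diagram (in $q$-degree $0$) in which the $i$-th and $(i+1)$-st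 points are joined to each other both at the bottom and at the top and all other strands are vertical. *The category $\mathrm{Kom}(n)$* consists of the chain complexes $\cdots\to P_k\xrightarrow{d_k}P_{k+1}\to\cdots$ ($k\in\mathbb Z$) of finite formal direct sums of objects of $\mathrm{Cob}(n)$ (that is, over the additive category $\mathrm{Mat}(\mathrm{Cob}(n))$) such that $P_k=0$ for all sufficiently negative $k$. In particular all differentials, chain maps and homotopies are matrices of degree zero maps. *Universal projectors.* A complex $P\in\mathrm{Kom}(n)$ is a *universal projector* if 1. $P_k=0$ for $k<0$, and for $k>0$ every summand $q^iD$ of $P_k$ has $i\ge 0$ (and the differential consists of degree zero maps); 2. $P_0\cong 1$, and for $k>0$ no shifted copy of the identity diagram splits off $P_k$: $P_k\not\cong q^j1\oplus D$ for all $j\in\mathbb Z$ and all $D\in\mathrm{Mat}(\mathrm{Cob}(n))$; 3. $P\otimes e_i\simeq 0$ and $e_i\otimes P\simeq 0$ for all $0<i<n$. **Claim.** If $C,D\in\mathrm{Kom}(n)$ are universal projectors, then $C$ and $D$ are chain homotopy equivalent, $C\simeq D$ (by degree zero chain maps and homotopies). -/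

import Mathlib

open CategoryTheory CategoryTheory.Limits ZeroObject
open scoped Polynomial

noncomputable section

namespace BarNatan

/-! ### Temperley-Lieb diagrams

A planar diagram in a strip, in Morse position, is read from one side to the other as a word of
elementary pieces, each creating or joining one pair of adjacent strands.  Every planar diagram
(possibly with closed circles) is isotopic to such a word; planar isotopies between words are
recorded below as invertible cobordisms. -/

/-- An elementary planar piece from `a` points to `b` points (points are numbered from `0`).
`cup m i` creates two adjacent points, which get the numbers `i` and `i + 1`;
`cap m i` joins the adjacent points `i` and `i + 1`.  All other strands run straight through. -/
inductive Piece : ℕ → ℕ → Type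
  | cup (m i : ℕ) (h : i ≤ m) : Piece m (m + 2)
  | cap (m i : ℕ) (h : i ≤ m) : Piece (m + 2) m

/-- The strands of an elementary piece, as edges between points `(level, position)`, where the
piece runs from level `0` to level `1`. -/
inductive Piece.Edge : {a b : ℕ} → Piece a b → ℕ × ℕ → ℕ × ℕ → Prop
  | cup_left {m i : ℕ} {h : i ≤ m} (x : ℕ) (hx : x < i) : Edge (.cup m i h) (0, x) (1, x)
  | cup_right {m i : ℕ} {h : i ≤ m} (x : ℕ) (hx : i ≤ x) : Edge (.cup m i h) (0, x) (1, x + 2)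
  | cup_arc {m i : ℕ} {h : i ≤ m} : Edge (.cup m i h) (1, i) (1, i + 1)
  | cap_left {m i : ℕ} {h : i ≤ m} (x : ℕ) (hx : x < i) : Edge (.cap m i h) (0, x) (1, x)
  | cap_right {m i : ℕ} {h : i ≤ m} (x : ℕ) (hx : i ≤ x) : Edge (.cap m i h) (0, x + 2) (1, x)
  | cap_arc {m i : ℕ} {h : i ≤ m} : Edge (.cap m i h) (0, i) (0, i + 1)

/-- Planar diagrams from `a` points to `b` points, as words of elementary pieces. -/
inductive Diag : ℕ → ℕ → Type
  | nil (m : ℕ) : Diag m m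
  | cons {a b c : ℕ} (p : Piece a b) (D : Diag b c) : Diag a c

namespace Diag

/-- Stacking of diagrams. -/
def comp : {a b c : ℕ} → Diag a b → Diag b c → Diag a c
  | _, _, _, .nil _, E => E
  | _, _, _, .cons p D, E => .cons p (D.comp E)

@[simp] theorem nil_comp {a b : ℕ} (E : Diag a b) : (nil a).comp E = E := rfl

@[simp] theorem cons_comp {a b c d : ℕ} (p : Piece a b) (D : Diag b c) (E : Diag c d) :
    (cons p D).comp E = cons p (D.comp E) := rfl

@[simp] theorem comp_nil {a b : ℕ} (D : Diag a b) : D.comp (nil b) = D := by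
  induction D with
  | nil => rfl
  | cons p D ih => simp [ih]

@[simp] theorem comp_assoc {a b c d : ℕ} (D : Diag a b) (E : Diag b c) (F : Diag c d) :
    (D.comp E).comp F = D.comp (E.comp F) := by
  induction D with
  | nil => rfl
  | cons p D ih => simp [ih]

/-- The number of elementary pieces. -/
def length : {a b : ℕ} → Diag a b → ℕ
  | _, _, .nil _ => 0
  | _, _, .cons _ D => D.length + 1

/-- `(level, position)` is one of the points in which the diagram meets the horizontal lines
separating its pieces (including the two outer lines). -/
def IsPoint : {a b : ℕ} → Diag a b → ℕ × ℕ → Prop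
  | _, _, .nil m, v => v.1 = 0 ∧ v.2 < m
  | a, _, .cons _ D, v => (v.1 = 0 ∧ v.2 < a) ∨ ∃ w, D.IsPoint w ∧ v = (w.1 + 1, w.2)

/-- The strands of a diagram, as edges between its points.  The connected components of the
resulting graph are the arcs and the circles of the diagram. -/
def Edge : {a b : ℕ} → Diag a b → ℕ × ℕ → ℕ × ℕ → Prop
  | _, _, .nil _, _, _ => False
  | _, _, .cons p D, v, w => p.Edge v w ∨
      ∃ v' w', D.Edge v' w' ∧ v = (v'.1 + 1, v'.2) ∧ w = (w'.1 + 1, w'.2)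

/-- The diagram with one piece. -/
def cup (m i : ℕ) (h : i ≤ m) : Diag m (m + 2) := .cons (.cup m i h) (.nil _)

/-- The diagram with one piece. -/
def cap (m i : ℕ) (h : i ≤ m) : Diag (m + 2) m := .cons (.cap m i h) (.nil _)

/-- `m` vertical strands and a small circle between the strands `i - 1` and `i`. -/
def circ (m i : ℕ) (h : i ≤ m) : Diag m m := (cup m i h).comp (cap m i h)

/-- The turnback on `m + 2` strands: the points `i` and `i + 1` are joined to each other on
either side, all other strands are vertical. -/
def turnback (m i : ℕ) (h : i ≤ m) : Diag (m + 2) (m + 2) := (cap m i h).comp (cup m i h)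

end Diag

open Diag

/-- The elementary planar isotopies: straightening a strand, and exchanging the heights of two
pieces that lie side by side. -/
inductive Isotopy : {a b : ℕ} → Diag a b → Diag a b → Type
  | zigzag_left (m i : ℕ) (h : i < m) :
      Isotopy (.nil m) ((cup m i h.le).comp (cap m (i + 1) h))
  | zigzag_right (m i : ℕ) (h : i < m) :
      Isotopy (.nil m) ((cup m (i + 1) h).comp (cap m i h.le))
  | cup_cup (m i j : ℕ) (hij : i ≤ j) (hj : j ≤ m) :
      Isotopy ((cup m j hj).comp (cup (m + 2) i (by omega)))
        ((cup m i (hij.trans hj)).comp (cup (m + 2) (j + 2) (by omega)))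
  | cap_cap (m i j : ℕ) (hij : i ≤ j) (hj : j ≤ m) :
      Isotopy ((cap (m + 2) i (by omega)).comp (cap m j hj))
        ((cap (m + 2) (j + 2) (by omega)).comp (cap m i (hij.trans hj)))
  | cap_cup_left (m i j : ℕ) (hij : i ≤ j) (hj : j ≤ m) :
      Isotopy ((cap m j hj).comp (cup m i (hij.trans hj)))
        ((cup (m + 2) i (by omega)).comp (cap (m + 2) (j + 2) (by omega)))
  | cap_cup_right (m i j : ℕ) (hij : i ≤ j) (hj : j ≤ m) :
      Isotopy ((cap m i (hij.trans hj)).comp (cup m j hj))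
        ((cup (m + 2) (j + 2) (by omega)).comp (cap (m + 2) i (by omega)))

/-! ### Dotted cobordisms

A dotted cobordism is presented by a movie, a sequence of diagrams in which consecutive ones
differ by one elementary move. -/

/-- The elementary moves: birth and death of a circle, the two directions of a saddle, a dot on
the strand `i`, and the traces of planar isotopies. -/
inductive Elem : {a b : ℕ} → Diag a b → Diag a b → Type
  | birth (m i : ℕ) (h : i ≤ m) : Elem (.nil m) (circ m i h)
  | death (m i : ℕ) (h : i ≤ m) : Elem (circ m i h) (.nil m)
  | saddle (m i : ℕ) (h : i ≤ m) : Elem (.nil (m + 2)) (turnback m i h)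
  | saddle' (m i : ℕ) (h : i ≤ m) : Elem (turnback m i h) (.nil (m + 2))
  | dot (m i : ℕ) (h : i < m) : Elem (.nil m) (.nil m)
  | iso {a b : ℕ} {D E : Diag a b} (r : Isotopy D E) : Elem D E
  | isoInv {a b : ℕ} {D E : Diag a b} (r : Isotopy D E) : Elem E D

namespace Elem

/-- The Euler characteristic of the elementary cobordism relative to its source, and its number
of dots. -/
def weight : {a b : ℕ} → {D E : Diag a b} → Elem D E → ℤ × ℕ
  | _, _, _, _, .birth .. => (1, 0)
  | _, _, _, _, .death .. => (1, 0)
  | _, _, _, _, .saddle .. => (-1, 0)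
  | _, _, _, _, .saddle' .. => (-1, 0)
  | _, _, _, _, .dot .. => (0, 1)
  | _, _, _, _, .iso _ => (0, 0)
  | _, _, _, _, .isoInv _ => (0, 0)

/-- A point `(time, level, position)` on the component of the elementary cobordism that carries
the critical point or the dot; time `0` is the source, time `1` the target.
(For isotopies, whose weight is zero, there is none.) -/
def marker : {a b : ℕ} → {D E : Diag a b} → Elem D E → Option (ℕ × ℕ × ℕ)
  | _, _, _, _, .birth _ i _ => some (1, 1, i)
  | _, _, _, _, .death _ i _ => some (0, 1, i)
  | _, _, _, _, .saddle _ i _ => some (0, 0, i)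
  | _, _, _, _, .saddle' _ i _ => some (0, 0, i)
  | _, _, _, _, .dot _ i _ => some (0, 0, i)
  | _, _, _, _, .iso _ => none
  | _, _, _, _, .isoInv _ => none

end Elem

/-- An elementary move inside a larger diagram: it replaces the part `l` of `D = u l v` by `r`,
and is the identity cobordism on `u` and `v`. -/
structure Move {a d : ℕ} (D E : Diag a d) where
  {b c : ℕ}
  u : Diag a b
  {l r : Diag b c}
  elem : Elem l r
  v : Diag c d
  source_eq : D = u.comp (l.comp v)
  target_eq : E = u.comp (r.comp v)

namespace Move

/-- The vertical sheets of the cobordism: they connect the points of the source outside `l`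
(including its two ends) to the same points of the target. -/
def Sheet {a d : ℕ} {D E : Diag a d} (s : Move D E) (v w : ℕ × ℕ) : Prop :=
  v.2 = w.2 ∧ ((v.1 = w.1 ∧ v.1 ≤ s.u.length) ∨
    ∃ k, v.1 = s.u.length + s.l.length + k ∧ w.1 = s.u.length + s.r.length + k)

/-- The weight of the move together with a point on the component that carries it. -/
def marks {a d : ℕ} {D E : Diag a d} (s : Move D E) : List ((ℕ × ℕ × ℕ) × (ℤ × ℕ)) :=
  (s.elem.marker.map fun p => ((p.1, s.u.length + p.2.1, p.2.2), s.elem.weight)).toList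

/-- The topological degree: a dot has degree `-2`. -/
def deg {a d : ℕ} {D E : Diag a d} (s : Move D E) : ℤ :=
  s.elem.weight.1 - 2 * s.elem.weight.2

/-- Stacking a move with the identity of a diagram. -/
def left {a b c : ℕ} (U : Diag a b) {D E : Diag b c} (s : Move D E) :
    Move (U.comp D) (U.comp E) :=
  ⟨U.comp s.u, s.elem, s.v, by simp [← s.source_eq], by simp [← s.target_eq]⟩

/-- Stacking a move with the identity of a diagram. -/
def right {a b c : ℕ} {D E : Diag a b} (s : Move D E) (V : Diag b c) :
    Move (D.comp V) (E.comp V) :=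
  ⟨s.u, s.elem, s.v.comp V, by simp [s.source_eq], by simp [s.target_eq]⟩

end Move

/-- An elementary move on a whole diagram. -/
def Elem.toMove {a b : ℕ} {D E : Diag a b} (s : Elem D E) : Move D E :=
  ⟨.nil _, s, .nil _, by simp, by simp⟩

/-- A dot on the small circle. -/
def circDot (m i : ℕ) (h : i ≤ m) : Move (circ m i h) (circ m i h) :=
  ⟨cup m i h, .dot (m + 2) i (by omega), cap m i h, rfl, rfl⟩

/-- Movies. -/
inductive Movie {a b : ℕ} : Diag a b → Diag a b → Type
  | nil (D : Diag a b) : Movie D D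
  | cons {D E F : Diag a b} (s : Move D E) (M : Movie E F) : Movie D F

namespace Movie

section

variable {a b c : ℕ}

/-- Composition of movies. -/
def comp : {D E F : Diag a b} → Movie D E → Movie E F → Movie D F
  | _, _, _, .nil _, N => N
  | _, _, _, .cons s M, N => .cons s (M.comp N)

@[simp] theorem nil_comp {D E : Diag a b} (M : Movie D E) : (nil D).comp M = M := rfl

@[simp] theorem cons_comp {D E F G : Diag a b} (s : Move D E) (M : Movie E F) (N : Movie F G) :
    (cons s M).comp N = cons s (M.comp N) := rfl

@[simp] theorem comp_nil {D E : Diag a b} (M : Movie D E) : M.comp (nil E) = M := by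
  induction M with
  | nil => rfl
  | cons s M ih => simp [ih]

@[simp] theorem comp_assoc {D E F G : Diag a b} (M : Movie D E) (N : Movie E F)
    (P : Movie F G) : (M.comp N).comp P = M.comp (N.comp P) := by
  induction M with
  | nil => rfl
  | cons s M ih => simp [ih]

/-- Stacking a movie with the identity of a diagram. -/
def left (U : Diag a b) : {D E : Diag b c} → Movie D E → Movie (U.comp D) (U.comp E)
  | _, _, .nil D => .nil (U.comp D)
  | _, _, .cons s M => .cons (s.left U) (M.left U)

/-- Stacking a movie with the identity of a diagram. -/
def right : {D E : Diag a b} → Movie D E → (V : Diag b c) → Movie (D.comp V) (E.comp V)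
  | _, _, .nil D, V => .nil (D.comp V)
  | _, _, .cons s M, V => .cons (s.right V) (M.right V)

theorem left_comp (U : Diag a b) {D E F : Diag b c} (M : Movie D E) (N : Movie E F) :
    (M.comp N).left U = (M.left U).comp (N.left U) := by
  induction M with
  | nil => rfl
  | cons s M ih => simp [left, ih]

theorem right_comp {D E F : Diag a b} (M : Movie D E) (N : Movie E F) (V : Diag b c) :
    (M.comp N).right V = (M.right V).comp (N.right V) := by
  induction M with
  | nil => rfl
  | cons s M ih => simp [right, ih]

/-- The topological degree of the cobordism, `χ - n` when there are no dots; each dot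
contributes `-2`. -/
def deg : {D E : Diag a b} → Movie D E → ℤ
  | _, _, .nil _ => 0
  | _, _, .cons s M => s.deg + M.deg

theorem deg_comp {D E F : Diag a b} (M : Movie D E) (N : Movie E F) :
    (M.comp N).deg = M.deg + N.deg := by
  induction M with
  | nil => simp [deg]
  | cons s M ih => simp [deg, ih, add_assoc]

theorem deg_left (U : Diag a b) {D E : Diag b c} (M : Movie D E) : (M.left U).deg = M.deg := by
  induction M with
  | nil => rfl
  | cons s M ih => simp only [left, deg, ih]; rfl

theorem deg_right {D E : Diag a b} (M : Movie D E) (V : Diag b c) :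
    (M.right V).deg = M.deg := by
  induction M with
  | nil => rfl
  | cons s M ih => simp only [right, deg, ih]; rfl

/-- The number of moves. -/
def length : {D E : Diag a b} → Movie D E → ℕ
  | _, _, .nil _ => 0
  | _, _, .cons _ M => M.length + 1

/-- `(time, level, position)` is a point of one of the diagrams of the movie. -/
def IsPoint : {D E : Diag a b} → Movie D E → ℕ × ℕ × ℕ → Prop
  | _, _, .nil D, p => p.1 = 0 ∧ D.IsPoint p.2
  | D, _, .cons _ M, p => (p.1 = 0 ∧ D.IsPoint p.2) ∨ ∃ q, M.IsPoint q ∧ p = (q.1 + 1, q.2)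

/-- Two points of the surface swept out by the movie are joined by a strand of one of the
diagrams, or by a vertical sheet between consecutive diagrams. -/
def Edge : {D E : Diag a b} → Movie D E → ℕ × ℕ × ℕ → ℕ × ℕ × ℕ → Prop
  | _, _, .nil D, p, q => p.1 = 0 ∧ q.1 = 0 ∧ D.Edge p.2 q.2
  | D, _, .cons s M, p, q =>
      (p.1 = 0 ∧ q.1 = 0 ∧ D.Edge p.2 q.2) ∨ (p.1 = 0 ∧ q.1 = 1 ∧ s.Sheet p.2 q.2) ∨
        ∃ p' q', M.Edge p' q' ∧ p = (p'.1 + 1, p'.2) ∧ q = (q'.1 + 1, q'.2)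

/-- All weights of the moves of the movie, with points on the components that carry them. -/
def marks : {D E : Diag a b} → Movie D E → List ((ℕ × ℕ × ℕ) × (ℤ × ℕ))
  | _, _, .nil _ => []
  | _, _, .cons s M => s.marks ++ M.marks.map fun k => ((k.1.1 + 1, k.1.2), k.2)

/-- The points of the surface that are used to keep track of its components (every component
contains some of them). -/
def Point {D E : Diag a b} (M : Movie D E) : Type := {p : ℕ × ℕ × ℕ // M.IsPoint p}

/-- Two points lie on the same component of the surface. -/
def connected {D E : Diag a b} (M : Movie D E) : Setoid M.Point :=
  Relation.EqvGen.setoid fun p q => M.Edge p.1 q.1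

/-- The connected components of the surface swept out by the movie. -/
def Component {D E : Diag a b} (M : Movie D E) : Type := Quotient M.connected

/-- The point `p` lies on the component `κ`. -/
def Component.Contains {D E : Diag a b} {M : Movie D E} (κ : M.Component) (p : ℕ × ℕ × ℕ) :
    Prop :=
  ∃ h : M.IsPoint p, Quotient.mk M.connected ⟨p, h⟩ = κ

open Classical in
/-- The Euler characteristic of a component relative to its part in the source diagram, and its
number of dots. -/
def Component.weight {D E : Diag a b} {M : Movie D E} (κ : M.Component) : ℤ × ℕ :=
  ((M.marks.filter fun k => κ.Contains k.1).map fun k => k.2).sum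

/-- Two movies sweep out dotted surfaces that are homeomorphic relative to the boundary: there is
a bijection between the components that respects the boundary points on them, the Euler
characteristics and the numbers of dots. By the classification of surfaces (all surfaces
here are orientable, being embedded in space) this determines the dotted surface. -/
def Homeomorphic {D E : Diag a b} (M N : Movie D E) : Prop :=
  ∃ φ : M.Component ≃ N.Component,
    (∀ κ v, D.IsPoint v → (κ.Contains (0, v) ↔ (φ κ).Contains (0, v))) ∧
    (∀ κ v, E.IsPoint v → (κ.Contains (M.length, v) ↔ (φ κ).Contains (N.length, v))) ∧
    ∀ κ, (φ κ).weight = κ.weight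

end

end Movie

/-! ### The linear category of dotted cobordisms -/

/-- The ground ring `ℤ[α]`, with `α` the polynomial variable. -/
abbrev Ground : Type := ℤ[X]

/-- Formal linear combinations of movies. -/
abbrev FreeHom {a b : ℕ} (D E : Diag a b) : Type := Movie D E →₀ Ground

/-- A movie as a formal linear combination. -/
def single {a b : ℕ} {D E : Diag a b} (M : Movie D E) : FreeHom D E := Finsupp.single M 1

/-- The movie of one move. -/
def Move.movie {a b : ℕ} {D E : Diag a b} (s : Move D E) : Movie D E := .cons s (.nil E)

/-- The birth of a small circle. -/
def birth (m i : ℕ) (h : i ≤ m) : Movie (.nil m) (circ m i h) := (Elem.birth m i h).toMove.movie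

/-- The death of a small circle. -/
def death (m i : ℕ) (h : i ≤ m) : Movie (circ m i h) (.nil m) := (Elem.death m i h).toMove.movie

/-- The sphere with `k` dots. -/
def sphere (m i : ℕ) (h : i ≤ m) (k : ℕ) : Movie (.nil m) (.nil m) :=
  (birth m i h).comp (Nat.iterate (fun M => .cons (circDot m i h) M) k (death m i h))

/-- The defining relations between formal combinations of dotted cobordisms: homeomorphic
dotted surfaces are equal (the relations `iso_inv`, `inv_iso` and `interchange` are instances of
this: an isotopy can be undone, and moves in different parts of a diagram may be exchanged in
time); the spheres with `0`, `1`, `2`, `3` dots are `0`, `1`, `0`, `α`; a tube around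
a small circle is cut into two discs, one of them dotted (neck cutting).  All relations are
local: they may be applied inside larger cobordisms. -/
inductive Relator : {a b : ℕ} → {D E : Diag a b} → FreeHom D E → Prop
  | homeo {a b : ℕ} {D E : Diag a b} (M N : Movie D E) (h : M.Homeomorphic N) :
      Relator (single M - single N)
  | iso_inv {a b : ℕ} {D E : Diag a b} (r : Isotopy D E) :
      Relator (single ((Elem.iso r).toMove.movie.comp (Elem.isoInv r).toMove.movie) -
        single (.nil D))
  | inv_iso {a b : ℕ} {D E : Diag a b} (r : Isotopy D E) :
      Relator (single ((Elem.isoInv r).toMove.movie.comp (Elem.iso r).toMove.movie) -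
        single (.nil E))
  | interchange {a b c : ℕ} {D D' : Diag a b} {E E' : Diag b c} (s : Move D D')
      (t : Move E E') :
      Relator (single ((s.right E).movie.comp (t.left D').movie) -
        single ((t.left D).movie.comp (s.right E').movie))
  | sphere_zero (m i : ℕ) (h : i ≤ m) : Relator (single (sphere m i h 0))
  | sphere_one (m i : ℕ) (h : i ≤ m) :
      Relator (single (sphere m i h 1) - single (.nil (.nil m)))
  | sphere_two (m i : ℕ) (h : i ≤ m) : Relator (single (sphere m i h 2))
  | sphere_three (m i : ℕ) (h : i ≤ m) :
      Relator (single (sphere m i h 3) - (Polynomial.X : Ground) • single (.nil (.nil m)))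
  | neck (m i : ℕ) (h : i ≤ m) :
      Relator (single (.nil (circ m i h)) -
        (single ((circDot m i h).movie.comp ((death m i h).comp (birth m i h))) +
          single ((death m i h).comp ((birth m i h).comp (circDot m i h).movie))))
  | pre {a b : ℕ} {D E F : Diag a b} (M : Movie D E) {x : FreeHom E F} (hx : Relator x) :
      Relator (Finsupp.lmapDomain Ground Ground (fun N => M.comp N) x)
  | post {a b : ℕ} {D E F : Diag a b} {x : FreeHom D E} (hx : Relator x) (N : Movie E F) :
      Relator (Finsupp.lmapDomain Ground Ground (fun M => M.comp N) x)
  | left {a b c : ℕ} (U : Diag a b) {D E : Diag b c} {x : FreeHom D E} (hx : Relator x) :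
      Relator (Finsupp.lmapDomain Ground Ground (fun M => M.left U) x)
  | right {a b c : ℕ} {D E : Diag a b} {x : FreeHom D E} (hx : Relator x) (V : Diag b c) :
      Relator (Finsupp.lmapDomain Ground Ground (fun M => M.right V) x)

/-- The submodule spanned by the relations. -/
def relations {a b : ℕ} (D E : Diag a b) : Submodule Ground (FreeHom D E) :=
  Submodule.span Ground {x | Relator x}

/-- The module of dotted cobordisms (of arbitrary degree) from `D` to `E`. -/
abbrev CobHom {a b : ℕ} (D E : Diag a b) : Type := FreeHom D E ⧸ relations D E

section

variable {a b c : ℕ}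

/-- The class of a movie. -/
def cls {D E : Diag a b} (M : Movie D E) : CobHom D E := (relations D E).mkQ (single M)

/-- Composition of formal combinations. -/
def freeComp (D E F : Diag a b) : FreeHom D E →ₗ[Ground] FreeHom E F →ₗ[Ground] FreeHom D F :=
  Finsupp.linearCombination Ground fun M => Finsupp.lmapDomain Ground Ground fun N => M.comp N

theorem freeComp_single {D E F : Diag a b} (M : Movie D E) (N : Movie E F) :
    freeComp D E F (single M) (single N) = single (M.comp N) := by
  simp [freeComp, single]

theorem freeComp_mem_right {D E F : Diag a b} (x : FreeHom D E) {y : FreeHom E F}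
    (hy : y ∈ relations E F) : freeComp D E F x y ∈ relations D F := by
  induction x using Finsupp.induction_linear with
  | zero => simp
  | add x x' hx hx' => simpa using add_mem hx hx'
  | single M r =>
    have h : Finsupp.lmapDomain Ground Ground (fun N => M.comp N) y ∈ relations D F := by
      induction hy using Submodule.span_induction with
      | mem y hy => exact Submodule.subset_span (Relator.pre M hy)
      | zero => simp
      | add y y' _ _ h h' => rw [map_add]; exact add_mem h h'
      | smul r y _ h => rw [map_smul]; exact Submodule.smul_mem _ _ h
    simpa [freeComp] using Submodule.smul_mem _ r h

theorem freeComp_mem_left {D E F : Diag a b} {x : FreeHom D E} (hx : x ∈ relations D E)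
    (y : FreeHom E F) : freeComp D E F x y ∈ relations D F := by
  induction y using Finsupp.induction_linear with
  | zero => simp
  | add y y' hy hy' => rw [map_add]; exact add_mem hy hy'
  | single N r =>
    have h : Finsupp.lmapDomain Ground Ground (fun M => M.comp N) x ∈ relations D F := by
      induction hx using Submodule.span_induction with
      | mem y hy => exact Submodule.subset_span (Relator.post hy N)
      | zero => simp
      | add y y' _ _ h h' => rw [map_add]; exact add_mem h h'
      | smul r y _ h => rw [map_smul]; exact Submodule.smul_mem _ _ h
    have e : freeComp D E F x (Finsupp.single N r) =
        r • Finsupp.lmapDomain Ground Ground (fun M => M.comp N) x := by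
      clear h hx
      induction x using Finsupp.induction_linear with
      | zero => simp
      | add x x' hx hx' => simp only [map_add, LinearMap.add_apply, smul_add, hx, hx']
      | single M s => simp [freeComp, mul_comm]
    rw [e]
    exact Submodule.smul_mem _ r h

/-- Composition of dotted cobordisms. -/
def cobComp (D E F : Diag a b) : CobHom D E →ₗ[Ground] CobHom E F →ₗ[Ground] CobHom D F :=
  (relations D E).liftQ
    { toFun := fun x => (relations E F).mapQ (relations D F) (freeComp D E F x)
        fun _ hy => freeComp_mem_right x hy
      map_add' := fun x x' => by ext; simp
      map_smul' := fun r x => by ext; simp }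
    (fun x hx => by
      rw [LinearMap.mem_ker]
      apply LinearMap.ext
      intro y
      obtain ⟨y, rfl⟩ := (relations E F).mkQ_surjective y
      exact (Submodule.Quotient.mk_eq_zero _).2 (freeComp_mem_left hx y))

theorem cobComp_cls {D E F : Diag a b} (M : Movie D E) (N : Movie E F) :
    cobComp D E F (cls M) (cls N) = cls (M.comp N) :=
  congrArg (relations D F).mkQ (freeComp_single M N)

/-- Dotted cobordisms are linear combinations of classes of movies. -/
theorem cobHom_induction {D E : Diag a b} {P : CobHom D E → Prop} (f : CobHom D E)
    (zero : P 0) (add : ∀ f g, P f → P g → P (f + g))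
    (smul : ∀ (r : Ground) (M : Movie D E), P (r • cls M)) : P f := by
  obtain ⟨x, rfl⟩ := (relations D E).mkQ_surjective f
  induction x using Finsupp.induction_linear with
  | zero => simpa using zero
  | add x x' hx hx' => rw [map_add]; exact add _ _ hx hx'
  | single M r =>
    have h : (Finsupp.single M r : FreeHom D E) = r • single M := by simp [single]
    rw [h, map_smul]
    exact smul r M

theorem cls_nil_comp {D E : Diag a b} (f : CobHom D E) :
    cobComp D D E (cls (.nil D)) f = f := by
  induction f using cobHom_induction with
  | zero => simp
  | add f g hf hg => rw [map_add, hf, hg]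
  | smul r M => rw [map_smul, cobComp_cls, Movie.nil_comp]

theorem comp_cls_nil {D E : Diag a b} (f : CobHom D E) :
    cobComp D E E f (cls (.nil E)) = f := by
  induction f using cobHom_induction with
  | zero => simp
  | add f g hf hg => rw [map_add, LinearMap.add_apply, hf, hg]
  | smul r M => rw [map_smul, LinearMap.smul_apply, cobComp_cls, Movie.comp_nil]

theorem cobComp_assoc {D E F G : Diag a b} (f : CobHom D E) (g : CobHom E F)
    (h : CobHom F G) :
    cobComp D F G (cobComp D E F f g) h = cobComp D E G f (cobComp E F G g h) := by
  induction f using cobHom_induction with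
  | zero => simp
  | add f f' hf hf' => simp only [map_add, LinearMap.add_apply, hf, hf']
  | smul r M =>
    induction g using cobHom_induction with
    | zero => simp
    | add g g' hg hg' => simp only [map_add, LinearMap.add_apply, hg, hg']
    | smul s N =>
      induction h using cobHom_induction with
      | zero => simp
      | add h h' hh hh' => simp only [map_add, hh, hh']
      | smul t P =>
        simp only [map_smul, LinearMap.smul_apply, cobComp_cls, Movie.comp_assoc]

/-- Gluing a dotted cobordism with the identity of a diagram. -/
def cobLeft (U : Diag a b) (D E : Diag b c) :
    CobHom D E →ₗ[Ground] CobHom (U.comp D) (U.comp E) :=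
  (relations D E).mapQ _ (Finsupp.lmapDomain Ground Ground fun M => M.left U)
    (Submodule.span_le.2 fun _ hx => Submodule.subset_span (Relator.left U hx))

/-- Gluing a dotted cobordism with the identity of a diagram. -/
def cobRight (D E : Diag a b) (V : Diag b c) :
    CobHom D E →ₗ[Ground] CobHom (D.comp V) (E.comp V) :=
  (relations D E).mapQ _ (Finsupp.lmapDomain Ground Ground fun M => M.right V)
    (Submodule.span_le.2 fun _ hx => Submodule.subset_span (Relator.right hx V))

theorem cobLeft_cls (U : Diag a b) {D E : Diag b c} (M : Movie D E) :
    cobLeft U D E (cls M) = cls (M.left U) :=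
  congrArg (relations _ _).mkQ (Finsupp.mapDomain_single (f := fun M : Movie D E => M.left U)
    (b := (1 : Ground)))

theorem cobRight_cls {D E : Diag a b} (M : Movie D E) (V : Diag b c) :
    cobRight D E V (cls M) = cls (M.right V) :=
  congrArg (relations _ _).mkQ (Finsupp.mapDomain_single (f := fun M : Movie D E => M.right V)
    (b := (1 : Ground)))

theorem cobLeft_comp (U : Diag a b) {D E F : Diag b c} (f : CobHom D E) (g : CobHom E F) :
    cobLeft U D F (cobComp D E F f g) = cobComp _ _ _ (cobLeft U D E f) (cobLeft U E F g) := by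
  induction f using cobHom_induction with
  | zero => simp
  | add f f' hf hf' => simp only [map_add, LinearMap.add_apply, hf, hf']
  | smul r M =>
    induction g using cobHom_induction with
    | zero => simp
    | add g g' hg hg' => simp only [map_add, hg, hg']
    | smul s N =>
      simp only [map_smul, LinearMap.smul_apply, cobComp_cls, cobLeft_cls, Movie.left_comp]

theorem cobRight_comp {D E F : Diag a b} (f : CobHom D E) (g : CobHom E F) (V : Diag b c) :
    cobRight D F V (cobComp D E F f g) =
      cobComp _ _ _ (cobRight D E V f) (cobRight E F V g) := by
  induction f using cobHom_induction with
  | zero => simp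
  | add f f' hf hf' => simp only [map_add, LinearMap.add_apply, hf, hf']
  | smul r M =>
    induction g using cobHom_induction with
    | zero => simp
    | add g g' hg hg' => simp only [map_add, hg, hg']
    | smul s N =>
      simp only [map_smul, LinearMap.smul_apply, cobComp_cls, cobRight_cls, Movie.right_comp]

/-- The dotted cobordisms of topological degree `d`: integral combinations of `α ^ k` times
a dotted surface, where `α`, being the value of a sphere with three dots, has degree `-4`. -/
def homogeneous (D E : Diag a b) (d : ℤ) : AddSubgroup (CobHom D E) :=
  AddSubgroup.closure
    {f | ∃ (k : ℕ) (M : Movie D E), M.deg - 4 * k = d ∧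
      f = (Polynomial.X ^ k : Ground) • cls M}

theorem homogeneous_id (D : Diag a b) : cls (.nil D) ∈ homogeneous D D 0 :=
  AddSubgroup.subset_closure ⟨0, .nil D, by simp [Movie.deg], by simp⟩

theorem homogeneous_comp {D E F : Diag a b} {d e : ℤ} {f : CobHom D E} {g : CobHom E F}
    (hf : f ∈ homogeneous D E d) (hg : g ∈ homogeneous E F e) :
    cobComp D E F f g ∈ homogeneous D F (d + e) := by
  induction hf using AddSubgroup.closure_induction with
  | zero => simp [zero_mem]
  | add f f' _ _ h h' => rw [map_add]; exact add_mem h h'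
  | neg f _ h => rw [map_neg]; exact neg_mem h
  | mem f hf =>
    obtain ⟨k, M, hM, rfl⟩ := hf
    induction hg using AddSubgroup.closure_induction with
    | zero => simp [zero_mem]
    | add g g' _ _ h h' => rw [map_add]; exact add_mem h h'
    | neg g _ h => rw [map_neg]; exact neg_mem h
    | mem g hg =>
      obtain ⟨l, N, hN, rfl⟩ := hg
      refine AddSubgroup.subset_closure ⟨k + l, M.comp N, ?_, ?_⟩
      · rw [Movie.deg_comp, ← hM, ← hN]; push_cast; ring
      · rw [map_smul, map_smul, LinearMap.smul_apply, cobComp_cls, smul_smul, pow_add, mul_comm]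

theorem homogeneous_left (U : Diag a b) {D E : Diag b c} {d : ℤ} {f : CobHom D E}
    (hf : f ∈ homogeneous D E d) : cobLeft U D E f ∈ homogeneous (U.comp D) (U.comp E) d := by
  induction hf using AddSubgroup.closure_induction with
  | zero => simp [zero_mem]
  | add f f' _ _ h h' => rw [map_add]; exact add_mem h h'
  | neg f _ h => rw [map_neg]; exact neg_mem h
  | mem f hf =>
    obtain ⟨k, M, hM, rfl⟩ := hf
    exact AddSubgroup.subset_closure
      ⟨k, M.left U, by rw [Movie.deg_left, hM], by rw [map_smul, cobLeft_cls]⟩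

theorem homogeneous_right {D E : Diag a b} {d : ℤ} {f : CobHom D E}
    (hf : f ∈ homogeneous D E d) (V : Diag b c) :
    cobRight D E V f ∈ homogeneous (D.comp V) (E.comp V) d := by
  induction hf using AddSubgroup.closure_induction with
  | zero => simp [zero_mem]
  | add f f' _ _ h h' => rw [map_add]; exact add_mem h h'
  | neg f _ h => rw [map_neg]; exact neg_mem h
  | mem f hf =>
    obtain ⟨k, M, hM, rfl⟩ := hf
    exact AddSubgroup.subset_closure
      ⟨k, M.right V, by rw [Movie.deg_right, hM], by rw [map_smul, cobRight_cls]⟩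

end

/-! ### The graded category, complexes, and universal projectors -/

/-- The objects `q ^ i D`: a diagram with `n + n` boundary points and a formal `q`-degree. -/
structure Cob (n : ℕ) where
  diag : Diag n n
  q : ℤ

variable {n : ℕ}

/-- The morphisms `q ^ i D ⟶ q ^ j E` are the dotted cobordisms of degree zero, i.e. those for
which the topological degree and the `q`-degree `j - i` add up to zero. -/
instance : Category (Cob n) where
  Hom A B := homogeneous A.diag B.diag (A.q - B.q)
  id A := ⟨cls (.nil A.diag), by rw [sub_self]; exact homogeneous_id A.diag⟩
  comp {A B C} f g := ⟨cobComp _ _ _ f.1 g.1, by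
    have h := homogeneous_comp f.2 g.2
    rwa [sub_add_sub_cancel] at h⟩
  id_comp f := Subtype.ext (cls_nil_comp f.1)
  comp_id f := Subtype.ext (comp_cls_nil f.1)
  assoc f g h := Subtype.ext (cobComp_assoc f.1 g.1 h.1)

instance : Preadditive (Cob n) where
  homGroup A B := inferInstanceAs (AddCommGroup (homogeneous A.diag B.diag (A.q - B.q)))
  add_comp _ _ _ f f' g := Subtype.ext (LinearMap.map_add₂ (cobComp _ _ _) f.1 f'.1 g.1)
  comp_add _ _ _ f g g' := Subtype.ext (map_add (cobComp _ _ _ f.1) g.1 g'.1)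

/-- The functor `U ⊗ -` on graded diagrams. -/
def stackLeft (U : Diag n n) : Cob n ⥤ Cob n where
  obj A := ⟨U.comp A.diag, A.q⟩
  map f := ⟨cobLeft U _ _ f.1, homogeneous_left U f.2⟩
  map_id A := Subtype.ext (cobLeft_cls U (.nil A.diag))
  map_comp f g := Subtype.ext (cobLeft_comp U f.1 g.1)

/-- The functor `- ⊗ V` on graded diagrams. -/
def stackRight (V : Diag n n) : Cob n ⥤ Cob n where
  obj A := ⟨A.diag.comp V, A.q⟩
  map f := ⟨cobRight _ _ V f.1, homogeneous_right f.2 V⟩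
  map_id A := Subtype.ext (cobRight_cls (.nil A.diag) V)
  map_comp f g := Subtype.ext (cobRight_comp f.1 g.1 V)

instance (U : Diag n n) : (stackLeft U).Additive where
  map_add {_ _ f g} := Subtype.ext (map_add (cobLeft U _ _) f.1 g.1)

instance (V : Diag n n) : (stackRight V).Additive where
  map_add {_ _ f g} := Subtype.ext (map_add (cobRight _ _ V) f.1 g.1)

/-- The additive category `Mat(Cob(n))` of finite formal direct sums. -/
abbrev MatCob (n : ℕ) : Type 1 := Mat_ (Cob n)

instance (F : Cob n ⥤ Cob n) [F.Additive] : F.mapMat_.Additive where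
  map_add {_ _ f g} := by
    apply Mat_.hom_ext
    intro i j
    exact F.map_add

instance : HasBinaryBiproducts (MatCob n) := hasBinaryBiproducts_of_finite_biproducts _

instance : HasZeroObject (MatCob n) := hasZeroObject_of_hasFiniteBiproducts (MatCob n)

/-- The chain complexes `⋯ ⟶ K_k ⟶ K_{k+1} ⟶ ⋯` in `Mat(Cob(n))` that vanish in all
sufficiently negative homological degrees. -/
def boundedBelow (n : ℕ) : ObjectProperty (CochainComplex (MatCob n) ℤ) :=
  fun K => ∃ N : ℤ, ∀ k < N, IsZero (K.X k)

/-- The category `Kom(n)`. -/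
abbrev Kom (n : ℕ) : Type 1 := (boundedBelow n).FullSubcategory

/-- The object `q ^ j 1`, the identity diagram in `q`-degree `j`. -/
def unit (n : ℕ) (j : ℤ) : MatCob n := (Mat_.embedding (Cob n)).obj ⟨.nil n, j⟩

/-- The generator `e_i` of the Temperley-Lieb algebra, for `0 < i < n`: it joins the `i`-th
and the `(i + 1)`-st point (counted from `1`) on either side. -/
def gen : (n i : ℕ) → 0 < i → i < n → Diag n n
  | 0, _, _, h => absurd h (by omega)
  | 1, _, _, h => absurd h (by omega)
  | m + 2, i, _, h => turnback m (i - 1) (by omega)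

/-- The complex `e ⊗ K`. -/
def tensorLeft (e : Diag n n) (K : CochainComplex (MatCob n) ℤ) : CochainComplex (MatCob n) ℤ :=
  ((stackLeft e).mapMat_.mapHomologicalComplex (ComplexShape.up ℤ)).obj K

/-- The complex `K ⊗ e`. -/
def tensorRight (K : CochainComplex (MatCob n) ℤ) (e : Diag n n) : CochainComplex (MatCob n) ℤ :=
  ((stackRight e).mapMat_.mapHomologicalComplex (ComplexShape.up ℤ)).obj K

/-- A complex is contractible if it is homotopy equivalent to zero. -/
def IsContractible (K : CochainComplex (MatCob n) ℤ) : Prop :=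
  Nonempty (HomotopyEquiv K (0 : CochainComplex (MatCob n) ℤ))

/-- Universal projectors.  (That the differential consists of degree zero maps is part of the
definition of the category `Cob n`.) -/
structure IsUniversalProjector (P : Kom n) : Prop where
  isZero_of_neg : ∀ k < 0, IsZero (P.obj.X k)
  q_nonneg : ∀ k > 0, ∀ s : (P.obj.X k).ι, 0 ≤ ((P.obj.X k).X s).q
  zero_iso : Nonempty (P.obj.X 0 ≅ unit n 0)
  /-- No shifted copy of the identity diagram is a summand in positive homological degree. -/
  not_iso : ∀ k > 0, ∀ (j : ℤ) (D : MatCob n), IsEmpty (P.obj.X k ≅ unit n j ⊞ D)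
  right_contractible : ∀ (i : ℕ) (h₀ : 0 < i) (h₁ : i < n),
    IsContractible (tensorRight P.obj (gen n i h₀ h₁))
  left_contractible : ∀ (i : ℕ) (h₀ : 0 < i) (h₁ : i < n),
    IsContractible (tensorLeft (gen n i h₀ h₁) P.obj)

end BarNatan

end

/-! If `e_i ⊗ K` is contractible for all `i`, then the complex of maps from `K` to any diagram `A`
that begins with a cap is exact: `A` is a retract of `q e_i ⊗ A` for a suitable `i`, because a
saddle followed by the death of the circle it creates is isotopic to the identity, and the saddles
are natural. Delooping, straightening zigzags and moving cups past caps show that every diagram in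
`Cob(n)` is a sum of shifts of a single diagram, which begins with a cap or is the identity, and
the identity does not split off a projector in positive degrees. So for `k > 0` the complex of maps
from either projector to the `k`-th term of either projector is exact, and obstruction theory
extends the isomorphism in degree zero and its inverse to mutually inverse homotopy equivalences.
-/

noncomputable section

namespace BarNatan

open Diag

section HomExact

universe v v' u u'

open CochainComplex CochainComplex.HomComplex

variable {A : Type u} [Category.{v} A] [Preadditive A]

/-- The complex of maps `K ⟶ Z` is exact: every cocycle `K.X p ⟶ Z` factors through the
differential of `K`. -/
def HomExact (K : CochainComplex A ℤ) (Z : A) : Prop :=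
  ∀ p q, p + 1 = q → ∀ φ : K.X p ⟶ Z, (∀ j, K.d j p ≫ φ = 0) → ∃ ψ : K.X q ⟶ Z, K.d p q ≫ ψ = φ

variable {K L : CochainComplex A ℤ}

theorem HomExact.exists_eqUpTo_δ_single {m n p p' q : ℤ} (hmn : m + 1 = n) (hp : p + 1 = p')
    (hq : p + n = q) (hK : HomExact K (L.X q)) (z : Cocycle K L n)
    (hz : ∀ i j (hij : i + n = j), i < p → z.1.v i j hij = 0) :
    ∃ ψ : K.X p' ⟶ L.X q, (δ m n (Cochain.single ψ m)).EqUpTo z.1 p := by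
  have killed (j : ℤ) : K.d j p ≫ z.1.v p q hq = 0 := by
    by_cases hj : j + 1 = p
    · have := Cochain.congr_v (z.δ_eq_zero (n + 1)) j q (by omega)
      rw [δ_v n (n + 1) rfl _ j q (by omega) (q - 1) p rfl hj, hz j _ _ (by omega)] at this
      rwa [zero_comp, zero_add, Cochain.zero_v, smul_eq_zero_iff_eq] at this
    · rw [K.shape j p hj, zero_comp]
  obtain ⟨ψ, hψ⟩ := hK p p' hp _ killed
  refine ⟨n.negOnePow • ψ, fun i j hij hi => ?_⟩
  rw [Cochain.δ_single _ m n hmn p (q + 1) hp rfl, Cochain.add_v,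
    Cochain.single_v_eq_zero _ _ _ _ _ (by omega), zero_add, Cochain.units_smul_v]
  obtain hi | rfl := hi.lt_or_eq
  · rw [Cochain.single_v_eq_zero _ _ _ _ _ (by omega), smul_zero, hz i j hij hi]
  · obtain rfl : j = q := by omega
    rw [Cochain.single_v, Linear.comp_units_smul, hψ, smul_smul, Int.units_mul_self, one_smul]

open Cochain.InductionUp in
theorem exists_δ_eq_of_homExact {m n p₀ : ℤ} (hmn : m + 1 = n) (z : Cocycle K L n)
    (hz : ∀ p q (hpq : p + n = q), p < p₀ → z.1.v p q hpq = 0)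
    (hK : ∀ p q, p₀ ≤ p → p + n = q → HomExact K (L.X q)) :
    ∃ α : Cochain K L m, δ m n α = z.1 ∧ α.EqUpTo 0 p₀ := by
  let X (k : ℕ) : Set (Cochain K L m) := Set.ofPred fun α => (δ m n α).EqUpTo z.1 (p₀ + k - 1)
  let α₀ : X 0 := ⟨0, fun p q hpq hp => by rw [δ_zero, hz p q hpq (by grind), Cochain.zero_v]⟩
  have improve (k : ℕ) (α : X k) : ∃ α' : X (k + 1), α'.1.EqUpTo α.1 (p₀ + k) := by
    let r : Cocycle K L n := .mk (z.1 - δ m n α.1) (n + 1) rfl (by rw [δ_sub, δ_δ]; simp)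
    obtain ⟨ψ, hψ⟩ := (hK (p₀ + k) _ (by omega) rfl).exists_eqUpTo_δ_single hmn rfl rfl r
      fun i j hij hi => sub_eq_zero.mpr (α.2 i j hij (by omega)).symm
    refine ⟨⟨α.1 + Cochain.single ψ m, fun i j hij hi => ?_⟩, fun i j hij hi => ?_⟩
    · rw [δ_add, Cochain.add_v, hψ i j hij (by grind)]
      exact add_sub_cancel _ _
    · rw [Cochain.add_v, Cochain.single_v_eq_zero _ _ _ _ _ (by omega), add_zero]
  choose φ hφ using improve
  have sequence_spec := limitSequence_eqUpTo φ hφ α₀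
  refine ⟨limitSequence φ hφ α₀, ?_, ?_⟩
  · ext p q hpq
    let k := (p - p₀ + 1).toNat
    rw [← (Cochain.InductionUp.sequence φ α₀ k).2 p q hpq (by grind),
      δ_v m n hmn _ p q hpq (q - 1) (p + 1) rfl rfl,
      δ_v m n hmn _ p q hpq (q - 1) (p + 1) rfl rfl,
      sequence_spec k p (q - 1) (by omega) (by omega),
      sequence_spec k (p + 1) q (by omega) (by omega)]
  · simpa only [Nat.cast_zero, add_zero] using! sequence_spec 0

theorem exists_hom_extending (hK : ∀ k < 0, IsZero (K.X k))
    (h : ∀ k > 0, HomExact K (L.X k)) (f₀ : K.X 0 ⟶ L.X 0) : ∃ f : K ⟶ L, f.f 0 = f₀ := by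
  let β : Cochain K L 0 := Cochain.single f₀ 0
  obtain ⟨α, hα, hα₀⟩ := exists_δ_eq_of_homExact (p₀ := 0) (zero_add 1)
    (.mk (δ 0 1 β) 2 rfl (δ_δ 0 1 2 β)) (fun p _ _ hp => (hK p hp).eq_of_src _ _)
    (fun p q hp hq => h q (by omega))
  refine ⟨Cocycle.homOf (.mk (β - α) 1 rfl (by rw [δ_sub, hα]; exact sub_self _)), ?_⟩
  calc (β - α).v 0 0 (add_zero 0) = f₀ - 0 := by
        rw [Cochain.sub_v, Cochain.single_v, hα₀ 0 0 rfl le_rfl, Cochain.zero_v]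
    _ = f₀ := sub_zero f₀

theorem nonempty_homotopy_zero (hK : ∀ k < 0, IsZero (K.X k))
    (h : ∀ k > 0, HomExact K (L.X k)) {f : K ⟶ L} (hf : f.f 0 = 0) :
    Nonempty (Homotopy f 0) := by
  have vanish (p q : ℤ) (hpq : p + 0 = q) (hp : p < 1) : (Cochain.ofHom f).v p q hpq = 0 := by
    obtain rfl : p = q := by omega
    rw [Cochain.ofHom_v]
    obtain hp | rfl : p < 0 ∨ p = 0 := by omega
    · exact (hK p hp).eq_of_src _ _
    · exact hf
  obtain ⟨α, hα, -⟩ := exists_δ_eq_of_homExact (neg_add_cancel 1) (Cocycle.ofHom f) vanish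
    (fun p q hp hq => h q (by omega))
  exact ⟨(Cochain.equivHomotopy f 0).symm ⟨α, by rw [hα, Cochain.ofHom_zero, add_zero]; rfl⟩⟩

theorem nonempty_homotopyEquiv (hK : ∀ k < 0, IsZero (K.X k)) (hL : ∀ k < 0, IsZero (L.X k))
    (hKK : ∀ k > 0, HomExact K (K.X k)) (hKL : ∀ k > 0, HomExact K (L.X k))
    (hLK : ∀ k > 0, HomExact L (K.X k)) (hLL : ∀ k > 0, HomExact L (L.X k))
    (e : K.X 0 ≅ L.X 0) : Nonempty (HomotopyEquiv K L) := by
  obtain ⟨f, hf⟩ := exists_hom_extending hK hKL e.hom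
  obtain ⟨g, hg⟩ := exists_hom_extending hL hLK e.inv
  obtain ⟨s⟩ := nonempty_homotopy_zero hK hKK (f := f ≫ g - 𝟙 K) (by simp [hf, hg])
  obtain ⟨t⟩ := nonempty_homotopy_zero hL hLL (f := g ≫ f - 𝟙 L) (by simp [hf, hg])
  exact ⟨⟨f, g, Homotopy.equivSubZero.symm s, Homotopy.equivSubZero.symm t⟩⟩

theorem HomExact.of_homotopy (h : Homotopy (𝟙 K) 0) (Z : A) : HomExact K Z := by
  rintro p _ rfl φ hφ
  refine ⟨h.hom (p + 1) p ≫ φ, ?_⟩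
  have id_eq : 𝟙 (K.X p) = K.d p (p + 1) ≫ h.hom (p + 1) p + h.hom p (p - 1) ≫ K.d (p - 1) p := by
    have := h.comm p
    rwa [dNext_eq h.hom (rfl : p + 1 = p + 1), prevD_eq h.hom (sub_add_cancel p 1),
      HomologicalComplex.zero_f, add_zero] at this
  calc K.d p (p + 1) ≫ h.hom (p + 1) p ≫ φ = 𝟙 (K.X p) ≫ φ := by
        rw [id_eq, Preadditive.add_comp, Category.assoc, Category.assoc, hφ, comp_zero, add_zero]
    _ = φ := Category.id_comp φ

theorem HomExact.of_retract {Y Z : A} (h : HomExact K Y) (r : Retract Z Y) : HomExact K Z := by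
  intro p q hpq φ hφ
  obtain ⟨ψ, hψ⟩ := h p q hpq (φ ≫ r.i) fun j => by rw [← Category.assoc, hφ, zero_comp]
  exact ⟨ψ ≫ r.r, by rw [← Category.assoc, hψ, Category.assoc, r.retract, Category.comp_id]⟩

theorem HomExact.biproduct {ι : Type*} {Y : ι → A} [HasBiproduct Y]
    (h : ∀ i, HomExact K (Y i)) : HomExact K (⨁ Y) := by
  intro p q hpq φ hφ
  choose ψ hψ using fun i => h i p q hpq (φ ≫ biproduct.π Y i) fun j => by
    rw [← Category.assoc, hφ, zero_comp]
  exact ⟨biproduct.lift ψ, by ext i; rw [Category.assoc, biproduct.lift_π, hψ]⟩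

theorem HomExact.of_natTrans {B : Type u'} [Category.{v'} B] [Preadditive B] {F : A ⥤ B}
    [F.PreservesZeroMorphisms] {G : B ⥤ A} (η : 𝟭 A ⟶ F ⋙ G) {Z : A}
    (ε : G.obj (F.obj Z) ⟶ Z) (hε : η.app Z ≫ ε = 𝟙 Z)
    (h : HomExact ((F.mapHomologicalComplex (.up ℤ)).obj K) (F.obj Z)) : HomExact K Z := by
  intro p q hpq φ hφ
  have killed (j : ℤ) : F.map (K.d j p) ≫ F.map φ = 0 := by rw [← F.map_comp, hφ, F.map_zero]
  obtain ⟨ψ, hψ⟩ : ∃ ψ : F.obj (K.X q) ⟶ F.obj Z, F.map (K.d p q) ≫ ψ = F.map φ :=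
    h p q hpq (F.map φ) killed
  have naturality {X Y : A} (f : X ⟶ Y) : f ≫ η.app Y = η.app X ≫ G.map (F.map f) :=
    η.naturality f
  refine ⟨η.app (K.X q) ≫ G.map ψ ≫ ε, ?_⟩
  calc K.d p q ≫ η.app (K.X q) ≫ G.map ψ ≫ ε
      = η.app (K.X p) ≫ G.map (F.map (K.d p q) ≫ ψ) ≫ ε := by
        rw [← Category.assoc, naturality, G.map_comp, Category.assoc, Category.assoc]
    _ = (φ ≫ η.app Z) ≫ ε := by rw [hψ, naturality, Category.assoc]
    _ = φ := by rw [Category.assoc, hε, Category.comp_id]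

/-- Splitting off the summand `Y i` of a biproduct. -/
def biproductIsoBiprod [HasFiniteBiproducts A] [HasBinaryBiproducts A] {ι : Type*} [Finite ι]
    (Y : ι → A) (i : ι) : (⨁ Y) ≅ Y i ⊞ ⨁ Subtype.restrict (· ≠ i) Y :=
  biprod.uniqueUpToIso _ _
    (isBilimitBinaryBiconeOfIsSplitMonoOfCokernel (biproduct.isColimitToSubtype Y i))

end HomExact

section Splitting

variable {a b c : ℕ}

theorem cls_mem_homogeneous {D E : Diag a b} (M : Movie D E) : cls M ∈ homogeneous D E M.deg :=
  AddSubgroup.subset_closure ⟨0, M, by simp, by simp⟩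

/-- A decomposition of `W` into a nonempty finite direct sum of graded shifts of `W'`. The shifts
are recorded as the degrees `d k` of the projections, so that `W` may carry any `q`-degree. -/
structure Splitting (W W' : Diag a b) where
  ι : Type
  [fintype : Fintype ι]
  [nonempty : Nonempty ι]
  d : ι → ℤ
  proj : ι → CobHom W W'
  incl : ι → CobHom W' W
  proj_mem : ∀ k, proj k ∈ homogeneous W W' (d k)
  incl_mem : ∀ k, incl k ∈ homogeneous W' W (-d k)
  total : ∑ k, cobComp W W' W (proj k) (incl k) = cls (.nil W)
  self : ∀ k, cobComp W' W W' (incl k) (proj k) = cls (.nil W')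
  ne : ∀ k l, k ≠ l → cobComp W' W W' (incl k) (proj l) = 0

namespace Splitting

attribute [instance] Splitting.fintype Splitting.nonempty

/-- The splitting with a single summand given by an isomorphism of degree zero. -/
def ofIso {W W' : Diag a b} (M : Movie W W') (N : Movie W' W) (hM : M.deg = 0) (hN : N.deg = 0)
    (h : cls (M.comp N) = cls (.nil W)) (h' : cls (N.comp M) = cls (.nil W')) :
    Splitting W W' where
  ι := Unit
  d _ := 0
  proj _ := cls M
  incl _ := cls N
  proj_mem _ := hM ▸ cls_mem_homogeneous M
  incl_mem _ := by simpa [hN] using cls_mem_homogeneous N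
  total := by simpa [cobComp_cls] using h
  self _ := by simpa [cobComp_cls] using h'
  ne _ _ h := absurd rfl h

/-- The trivial splitting. -/
def refl (W : Diag a b) : Splitting W W := ofIso (.nil W) (.nil W) rfl rfl rfl rfl

/-- The refinement of a splitting obtained by splitting its repeated summand. -/
def trans {W W' W'' : Diag a b} (S : Splitting W W') (T : Splitting W' W'') :
    Splitting W W'' where
  ι := S.ι × T.ι
  d k := S.d k.1 + T.d k.2
  proj k := cobComp _ _ _ (S.proj k.1) (T.proj k.2)
  incl k := cobComp _ _ _ (T.incl k.2) (S.incl k.1)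
  proj_mem k := homogeneous_comp (S.proj_mem _) (T.proj_mem _)
  incl_mem k := by
    rw [neg_add_rev]
    exact homogeneous_comp (T.incl_mem _) (S.incl_mem _)
  total := by
    rw [Fintype.sum_prod_type, ← S.total]
    refine Finset.sum_congr rfl fun i _ => ?_
    have h (j : T.ι) : cobComp W W'' W (cobComp W W' W'' (S.proj i) (T.proj j))
        (cobComp W'' W' W (T.incl j) (S.incl i)) = cobComp W W' W (S.proj i)
          (cobComp W' W' W (cobComp W' W'' W' (T.proj j) (T.incl j)) (S.incl i)) := by
      simp only [cobComp_assoc]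
    simp only [h]
    rw [← map_sum, ← LinearMap.sum_apply, ← map_sum, T.total, cls_nil_comp]
  self k := by
    rw [cobComp_assoc, ← cobComp_assoc (S.incl _), S.self, cls_nil_comp, T.self]
  ne k l h := by
    rw [cobComp_assoc, ← cobComp_assoc (S.incl _)]
    by_cases h₁ : k.1 = l.1
    · rw [h₁, S.self, cls_nil_comp, T.ne _ _ fun h₂ => h (Prod.ext h₁ h₂)]
    · rw [S.ne _ _ h₁, map_zero, LinearMap.zero_apply, map_zero]

/-- The splitting `U ⊗ S`. -/
def left (U : Diag a b) {W W' : Diag b c} (S : Splitting W W') :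
    Splitting (U.comp W) (U.comp W') where
  ι := S.ι
  d := S.d
  proj k := cobLeft U _ _ (S.proj k)
  incl k := cobLeft U _ _ (S.incl k)
  proj_mem k := homogeneous_left U (S.proj_mem k)
  incl_mem k := homogeneous_left U (S.incl_mem k)
  total := by simp only [← cobLeft_comp, ← map_sum, S.total, cobLeft_cls, Movie.left]
  self k := by simp only [← cobLeft_comp, S.self, cobLeft_cls, Movie.left]
  ne k l h := by simp only [← cobLeft_comp, S.ne k l h, map_zero]

/-- The splitting `S ⊗ V`. -/
def right {W W' : Diag a b} (S : Splitting W W') (V : Diag b c) :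
    Splitting (W.comp V) (W'.comp V) where
  ι := S.ι
  d := S.d
  proj k := cobRight _ _ V (S.proj k)
  incl k := cobRight _ _ V (S.incl k)
  proj_mem k := homogeneous_right (S.proj_mem k) V
  incl_mem k := homogeneous_right (S.incl_mem k) V
  total := by simp only [← cobRight_comp, ← map_sum, S.total, cobRight_cls, Movie.right]
  self k := by simp only [← cobRight_comp, S.self, cobRight_cls, Movie.right]
  ne k l h := by simp only [← cobRight_comp, S.ne k l h, map_zero]

end Splitting

theorem mkQ_eq_zero_of_relator {D E : Diag a b} {x : FreeHom D E} (h : Relator x) :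
    (relations D E).mkQ x = 0 :=
  (Submodule.Quotient.mk_eq_zero _).2 (Submodule.subset_span h)

theorem cls_eq_cls_of_relator {D E : Diag a b} {M N : Movie D E}
    (h : Relator (single M - single N)) : cls M = cls N := by
  simpa only [cls, map_sub, sub_eq_zero] using mkQ_eq_zero_of_relator h

theorem neck_cutting (m i : ℕ) (h : i ≤ m) :
    cls (.nil (circ m i h)) =
      cls ((circDot m i h).movie.comp ((death m i h).comp (birth m i h))) +
        cls ((death m i h).comp ((birth m i h).comp (circDot m i h).movie)) := by
  simpa only [cls, map_sub, map_add, sub_eq_zero] using mkQ_eq_zero_of_relator (.neck m i h)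

/-- The splitting of the target of an isotopy, whose single summand is the source. -/
def Isotopy.splitting {D E : Diag a b} (r : Isotopy D E) : Splitting E D :=
  .ofIso (Elem.isoInv r).toMove.movie (Elem.iso r).toMove.movie rfl rfl
    (cls_eq_cls_of_relator (.inv_iso r)) (cls_eq_cls_of_relator (.iso_inv r))

/-- Delooping: a circle is `q⁻¹ ∅ ⊕ q ∅`. The summand `true` is the one whose projection carries
a dot. -/
def circSplitting (m i : ℕ) (h : i ≤ m) : Splitting (circ m i h) (.nil m) where
  ι := Bool
  d k := bif k then -1 else 1
  proj k := bif k then cls ((circDot m i h).movie.comp (death m i h)) else cls (death m i h)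
  incl k := bif k then cls (birth m i h) else cls ((birth m i h).comp (circDot m i h).movie)
  proj_mem := by
    rintro (_ | _)
    · exact cls_mem_homogeneous (death m i h)
    · exact cls_mem_homogeneous ((circDot m i h).movie.comp (death m i h))
  incl_mem := by
    rintro (_ | _)
    · exact cls_mem_homogeneous ((birth m i h).comp (circDot m i h).movie)
    · exact cls_mem_homogeneous (birth m i h)
  total := by
    rw [neck_cutting]
    simp [cobComp_cls]
  self := by
    rintro (_ | _) <;>
    · simp only [cond_true, cond_false, cobComp_cls]
      exact cls_eq_cls_of_relator (.sphere_one m i h)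
  ne := by
    rintro (_ | _) (_ | _) hkl
    · exact absurd rfl hkl
    · simp only [cond_true, cond_false, cobComp_cls]
      exact mkQ_eq_zero_of_relator (.sphere_two m i h)
    · simp only [cond_true, cond_false, cobComp_cls]
      exact mkQ_eq_zero_of_relator (.sphere_zero m i h)
    · exact absurd rfl hkl

namespace Splitting

variable {n : ℕ} {W W' : Diag n n} (S : Splitting W W') (q : ℤ)

/-- The splitting as a direct sum diagram of degree zero maps. -/
def bicone : Bicone fun k => (⟨W', q - S.d k⟩ : Cob n) where
  pt := ⟨W, q⟩
  π k := ⟨S.proj k, by simpa using S.proj_mem k⟩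
  ι k := ⟨S.incl k, by simpa using S.incl_mem k⟩
  ι_π k l := by
    split_ifs with h
    · subst h
      exact Subtype.ext (S.self k)
    · exact Subtype.ext (S.ne k l h)

/-- The direct sum decomposition of the object `q ^ q W` of `Mat(Cob(n))`. -/
def isoBiproduct : (Mat_.embedding (Cob n)).obj ⟨W, q⟩ ≅
    ⨁ fun k => (Mat_.embedding (Cob n)).obj ⟨W', q - S.d k⟩ :=
  have total : ∑ k, (S.bicone q).π k ≫ (S.bicone q).ι k = 𝟙 (S.bicone q).pt :=
    Subtype.ext ((AddSubgroup.val_finsetSum _ _ _).trans S.total)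
  biproduct.uniqueUpToIso (b := (Mat_.embedding (Cob n)).mapBicone (S.bicone q)) _
    (isBilimitOfPreserves _ (isBilimitOfTotal _ total))

end Splitting

/-- Diagrams without caps, one of the two normal forms of diagrams up to splitting. -/
inductive IsCups : {a b : ℕ} → Diag a b → Prop
  | nil (m : ℕ) : IsCups (.nil m)
  | cons {m i b : ℕ} (h : i ≤ m) {D : Diag (m + 2) b} : IsCups D → IsCups (.cons (.cup m i h) D)

theorem IsCups.le {D : Diag a b} (h : IsCups D) : a ≤ b := by
  induction h with
  | nil => exact le_rfl
  | cons _ _ ih => omega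

theorem IsCups.eq_nil {D : Diag a a} (h : IsCups D) : D = .nil a := by
  cases h with
  | nil => rfl
  | cons _ h => exact absurd h.le (by omega)

/-- Diagrams whose lowest piece is a cap, the other normal form of diagrams up to splitting. -/
inductive StartsWithCap : {a b : ℕ} → Diag a b → Prop
  | cons {m i b : ℕ} (h : i ≤ m) (D : Diag m b) : StartsWithCap (.cons (.cap m i h) D)

theorem StartsWithCap.comp {W : Diag a b} (h : StartsWithCap W) (V : Diag b c) :
    StartsWithCap (W.comp V) := by
  cases h with
  | cons h D => exact .cons h (D.comp V)

theorem length_comp (D : Diag a b) (E : Diag b c) : (D.comp E).length = D.length + E.length := by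
  induction D with
  | nil => exact (Nat.zero_add _).symm
  | cons p D ih => simp only [cons_comp, Diag.length, ih]; omega

theorem exists_splitting_cup_comp_cap {m i j : ℕ} (hi : i ≤ m) (hj : j ≤ m) :
    Nonempty (Splitting ((cup m i hi).comp (cap m j hj)) (.nil m)) ∨
      ∃ W, StartsWithCap W ∧ W.length = 2 ∧
        Nonempty (Splitting ((cup m i hi).comp (cap m j hj)) W) := by
  obtain rfl | rfl | rfl | hij | hij :
    i = j ∨ j = i + 1 ∨ i = j + 1 ∨ i + 2 ≤ j ∨ j + 2 ≤ i := by omega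
  · exact .inl ⟨circSplitting m i hi⟩
  · exact .inl ⟨(Isotopy.zigzag_left m i hj).splitting⟩
  · exact .inl ⟨(Isotopy.zigzag_right m j hi).splitting⟩
  · obtain ⟨m, rfl⟩ := Nat.exists_eq_add_of_le' (hij.trans hj |> le_of_add_le_right)
    obtain ⟨j, rfl⟩ := Nat.exists_eq_add_of_le' (le_of_add_le_right hij)
    have hle : i ≤ j := by omega
    have hm : j ≤ m := by omega
    exact .inr ⟨_, .cons hm _, rfl, ⟨(Isotopy.cap_cup_left m i j hle hm).splitting⟩⟩
  · obtain ⟨m, rfl⟩ := Nat.exists_eq_add_of_le' (hij.trans hi |> le_of_add_le_right)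
    obtain ⟨i, rfl⟩ := Nat.exists_eq_add_of_le' (le_of_add_le_right hij)
    have hle : j ≤ i := by omega
    have hm : i ≤ m := by omega
    exact .inr ⟨_, .cons (hle.trans hm) _, rfl, ⟨(Isotopy.cap_cup_right m j i hle hm).splitting⟩⟩

theorem exists_splitting_isCups_or_startsWithCap (D : Diag a b) :
    ∃ W, W.length ≤ D.length ∧ Nonempty (Splitting D W) ∧ (IsCups W ∨ StartsWithCap W) := by
  induction hN : D.length using Nat.strong_induction_on generalizing a with
  | _ N ih =>
  cases D with
  | nil => exact ⟨_, hN.le, ⟨.refl _⟩, .inl (.nil b)⟩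
  | cons p D =>
    cases p with
    | cap m i hi => exact ⟨_, hN.le, ⟨.refl _⟩, .inr (.cons hi D)⟩
    | cup _ i hi =>
      have hD : D.length + 1 = N := hN
      obtain ⟨W, hW, ⟨S⟩, hcups | ⟨hj, V⟩⟩ := ih D.length (by omega) D rfl
      · exact ⟨_, hD ▸ Nat.succ_le_succ hW, ⟨S.left (cup _ i hi)⟩, .inl (.cons hi hcups)⟩
      have hV : V.length + 1 ≤ D.length := hW
      obtain ⟨⟨T⟩⟩ | ⟨W, hcap, hlen, ⟨T⟩⟩ := exists_splitting_cup_comp_cap hi hj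
      · obtain ⟨W, hWV, ⟨S'⟩, h⟩ := ih V.length (by omega) V rfl
        exact ⟨W, by omega, ⟨((S.left (cup _ i hi)).trans (T.right V)).trans S'⟩, h⟩
      · exact ⟨W.comp V, by rw [length_comp]; omega,
          ⟨(S.left (cup _ i hi)).trans (T.right V)⟩, .inr (hcap.comp V)⟩

end Splitting

section MapMat

universe v u u'

variable {A : Type u} [Category.{v} A] [Preadditive A] {B : Type u'} [Category.{v} B]
  [Preadditive B] {F G : A ⥤ B} [F.Additive] [G.Additive]

/-- The extension of a natural transformation to formal direct sums: the diagonal matrix of its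
components, encoded as the image under `G` of the identity matrix. -/
def mapMatNatTrans (α : F ⟶ G) : F.mapMat_ ⟶ G.mapMat_ where
  app M i j := α.app (M.X i) ≫ G.map ((𝟙 M : M ⟶ M) i j)
  naturality M N f := by
    apply Mat_.hom_ext
    intro i k
    have id_comp : ∑ j, (𝟙 M : M ⟶ M) i j ≫ f j k = f i k := congrFun₂ (Category.id_comp f) i k
    have comp_id : ∑ j, f i j ≫ (𝟙 N : N ⟶ N) j k = f i k := congrFun₂ (Category.comp_id f) i k
    calc ∑ j, F.map (f i j) ≫ α.app (N.X j) ≫ G.map ((𝟙 N : N ⟶ N) j k)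
        = α.app (M.X i) ≫ G.map (∑ j, f i j ≫ (𝟙 N : N ⟶ N) j k) := by
          simp only [α.naturality_assoc, G.map_sum, G.map_comp, Preadditive.comp_sum]
      _ = α.app (M.X i) ≫ G.map (∑ j, (𝟙 M : M ⟶ M) i j ≫ f j k) := by rw [id_comp, comp_id]
      _ = ∑ j, (α.app (M.X i) ≫ G.map ((𝟙 M : M ⟶ M) i j)) ≫ G.map (f j k) := by
          simp only [Category.assoc, G.map_sum, G.map_comp, Preadditive.comp_sum]

theorem mapMatNatTrans_app_embedding (α : F ⟶ G) (X : A) :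
    (mapMatNatTrans α).app ((Mat_.embedding A).obj X) = (Mat_.embedding B).map (α.app X) := by
  apply Mat_.hom_ext
  rintro ⟨⟩ ⟨⟩
  have id_eq : (𝟙 ((Mat_.embedding A).obj X) : _ ⟶ _) PUnit.unit PUnit.unit = 𝟙 X :=
    Mat_.id_apply_self _ _
  have app_comp_id : α.app X ≫ G.map (𝟙 X) = α.app X := by rw [G.map_id, Category.comp_id]
  exact (congrArg (α.app X ≫ G.map ·) id_eq).trans app_comp_id

end MapMat

section Interchange

variable {a b c : ℕ}

theorem cobComp_cobRight_cobLeft_move {D D' : Diag a b} {E E' : Diag b c} (s : Move D D')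
    (N : Movie E E') :
    cobComp _ _ _ (cobRight D D' E (cls s.movie)) (cobLeft D' E E' (cls N)) =
      cobComp _ _ _ (cobLeft D E E' (cls N)) (cobRight D D' E' (cls s.movie)) := by
  induction N with
  | nil E => simp only [cobLeft_cls, Movie.left, comp_cls_nil, cls_nil_comp]
  | @cons E F E' t N ih =>
    have cls_cons : cls (.cons t N) = cobComp _ _ _ (cls t.movie) (cls N) :=
      (cobComp_cls t.movie N).symm
    have interchange : cobComp _ _ _ (cobRight D D' E (cls s.movie)) (cobLeft D' E F (cls t.movie))
        = cobComp _ _ _ (cobLeft D E F (cls t.movie)) (cobRight D D' F (cls s.movie)) := by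
      simp only [cobRight_cls, cobLeft_cls, cobComp_cls]
      exact cls_eq_cls_of_relator (.interchange s t)
    rw [cls_cons, cobLeft_comp, cobLeft_comp, ← cobComp_assoc, interchange, cobComp_assoc, ih,
      cobComp_assoc]

theorem cobComp_cobRight_cobLeft_movie {D D' : Diag a b} {E E' : Diag b c} (M : Movie D D')
    (N : Movie E E') :
    cobComp _ _ _ (cobRight D D' E (cls M)) (cobLeft D' E E' (cls N)) =
      cobComp _ _ _ (cobLeft D E E' (cls N)) (cobRight D D' E' (cls M)) := by
  induction M with
  | nil D => simp only [cobRight_cls, Movie.right, comp_cls_nil, cls_nil_comp]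
  | @cons D F D' s M ih =>
    have cls_cons : cls (.cons s M) = cobComp _ _ _ (cls s.movie) (cls M) :=
      (cobComp_cls s.movie M).symm
    rw [cls_cons, cobRight_comp, cobRight_comp, cobComp_assoc, ih, ← cobComp_assoc,
      cobComp_cobRight_cobLeft_move, cobComp_assoc]

theorem cobComp_cobRight_cobLeft {D D' : Diag a b} {E E' : Diag b c} (f : CobHom D D')
    (g : CobHom E E') :
    cobComp _ _ _ (cobRight D D' E f) (cobLeft D' E E' g) =
      cobComp _ _ _ (cobLeft D E E' g) (cobRight D D' E' f) := by
  induction f using cobHom_induction with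
  | zero => simp
  | add f f' hf hf' => simp only [map_add, LinearMap.add_apply, hf, hf']
  | smul r M =>
    induction g using cobHom_induction with
    | zero => simp
    | add g g' hg hg' => simp only [map_add, LinearMap.add_apply, hg, hg']
    | smul t N =>
      simp only [map_smul, LinearMap.smul_apply, cobComp_cobRight_cobLeft_movie]
      exact smul_comm t r _

theorem Movie.left_nil {D E : Diag a b} (M : Movie D E) : M.left (.nil a) = M := by
  induction M with
  | nil => rfl
  | cons s M ih => exact congrArg (Movie.cons s) ih

theorem cobLeft_nil {D E : Diag a b} (f : CobHom D E) : cobLeft (.nil a) D E f = f := by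
  induction f using cobHom_induction with
  | zero => exact map_zero _
  | add f g hf hg => exact (map_add _ f g).trans (congrArg₂ _ hf hg)
  | smul r M =>
    have cobLeft_nil_cls : cobLeft (.nil a) D E (cls M) = cls M :=
      (cobLeft_cls _ M).trans (congrArg cls M.left_nil)
    exact (map_smul _ r _).trans (congrArg (r • ·) cobLeft_nil_cls)

/-- The shift of the `q`-degree. -/
def qShift (n : ℕ) (s : ℤ) : Cob n ⥤ Cob n where
  obj A := ⟨A.diag, A.q + s⟩
  map {A B} f := ⟨f.1, by rw [add_sub_add_right_eq_sub]; exact f.2⟩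
  map_id _ := rfl
  map_comp _ _ := rfl

instance (n : ℕ) (s : ℤ) : (qShift n s).Additive where
  map_add := rfl

/-- Gluing with a cobordism out of the identity diagram. Shifting the `q`-degree of the target
makes the components maps of degree zero. -/
def stackLeftNatTrans {n : ℕ} {U : Diag n n} {d : ℤ} {f : CobHom (.nil n) U}
    (hf : f ∈ homogeneous (.nil n) U (-d)) : 𝟭 (Cob n) ⟶ stackLeft U ⋙ qShift n d where
  app A := ⟨cobRight (.nil n) U A.diag f, by
    change _ ∈ homogeneous _ _ (A.q - (A.q + d))
    rw [sub_add_cancel_left]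
    exact homogeneous_right hf A.diag⟩
  naturality A B g := Subtype.ext <|
    calc cobComp A.diag B.diag (U.comp B.diag) g.1 (cobRight (.nil n) U B.diag f)
        = cobComp A.diag B.diag (U.comp B.diag) (cobLeft (.nil n) A.diag B.diag g.1)
            (cobRight (.nil n) U B.diag f) :=
          congrArg (cobComp A.diag B.diag _ · _) (cobLeft_nil g.1).symm
      _ = cobComp A.diag (U.comp A.diag) (U.comp B.diag) (cobRight (.nil n) U A.diag f)
            (cobLeft U A.diag B.diag g.1) := (cobComp_cobRight_cobLeft f g.1).symm

end Interchange

namespace Movie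

variable {a b : ℕ} {D E : Diag a b}

theorem isPoint_source (M : Movie D E) {v : ℕ × ℕ} (hv : D.IsPoint v) : M.IsPoint (0, v) := by
  cases M with
  | nil => exact ⟨rfl, hv⟩
  | cons s M => exact .inl ⟨rfl, hv⟩

theorem isPoint_target (M : Movie D E) {v : ℕ × ℕ} (hv : E.IsPoint v) :
    M.IsPoint (M.length, v) := by
  induction M with
  | nil => exact ⟨rfl, hv⟩
  | cons s M ih => exact .inr ⟨(M.length, v), ih hv, rfl⟩

theorem edge_source (M : Movie D E) {v w : ℕ × ℕ} (h : D.Edge v w) : M.Edge (0, v) (0, w) := by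
  cases M with
  | nil => exact ⟨rfl, rfl, h⟩
  | cons s M => exact .inl ⟨rfl, rfl, h⟩

/-- The component of the surface of a movie through the point `p`. -/
def component (M : Movie D E) (p : ℕ × ℕ × ℕ) (hp : M.IsPoint p) : M.Component :=
  Quotient.mk M.connected ⟨p, hp⟩

theorem component_eq_of_edge {M : Movie D E} {p q : ℕ × ℕ × ℕ} (hp : M.IsPoint p)
    (hq : M.IsPoint q) (h : M.Edge p q) : M.component p hp = M.component q hq :=
  Quotient.sound (.rel _ _ h)

theorem contains_iff {M : Movie D E} (κ : M.Component) {p : ℕ × ℕ × ℕ} (hp : M.IsPoint p) :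
    κ.Contains p ↔ M.component p hp = κ :=
  exists_prop_of_true hp

theorem homeomorphic_nil_of_retraction (M : Movie D D) (r : ℕ × ℕ × ℕ → ℕ × ℕ)
    (isPoint_r : ∀ p, M.IsPoint p → D.IsPoint (r p))
    (r_edge : ∀ p q, M.Edge p q → r p = r q ∨ D.Edge (r p) (r q) ∨ D.Edge (r q) (r p))
    (component_r : ∀ p (hp : M.IsPoint p),
      M.component (0, r p) (M.isPoint_source (isPoint_r p hp)) = M.component p hp)
    (r_source : ∀ v, D.IsPoint v → r (0, v) = v)
    (r_target : ∀ v, D.IsPoint v → r (M.length, v) = v)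
    (weight_eq_zero : ∀ κ : M.Component, κ.weight = 0) : M.Homeomorphic (.nil D) := by
  let toNil (p : M.Point) : (Movie.nil D).Component :=
    (Movie.nil D).component (0, r p.1) ⟨rfl, isPoint_r p.1 p.2⟩
  let ofNil (p : (Movie.nil D).Point) : M.Component := M.component _ (M.isPoint_source p.2.2)
  have toNil_eq : M.connected ≤ Setoid.ker toNil := Setoid.eqvGen_le fun p q h => by
    obtain h | h | h := r_edge p.1 q.1 h
    · simp only [Setoid.ker_def, toNil, h]
    · exact component_eq_of_edge _ _ (edge_source (.nil D) h)
    · exact (component_eq_of_edge _ _ (edge_source (.nil D) h)).symm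
  have ofNil_eq : (Movie.nil D).connected ≤ Setoid.ker ofNil :=
    Setoid.eqvGen_le fun _ _ h => component_eq_of_edge _ _ (M.edge_source h.2.2)
  let φ : M.Component ≃ (Movie.nil D).Component :=
    { toFun := Quotient.lift toNil fun _ _ h => toNil_eq h
      invFun := Quotient.lift ofNil fun _ _ h => ofNil_eq h
      left_inv := by
        rintro ⟨p⟩
        exact component_r p.1 p.2
      right_inv := by
        rintro ⟨⟨t, v⟩, ht, hv⟩
        obtain rfl : t = 0 := ht
        change (Movie.nil D).component (0, r (0, v)) _ = (Movie.nil D).component (0, v) _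
        simp only [r_source v hv] }
  have φ_contains (κ : M.Component) (t : ℕ) (v : ℕ × ℕ) (hv : D.IsPoint v)
      (htv : M.IsPoint (t, v)) (r_eq : r (t, v) = v) :
      κ.Contains (t, v) ↔ (φ κ).Contains (0, v) := by
    have φ_component :
        φ (M.component (t, v) htv) = (Movie.nil D).component (0, v) ⟨rfl, hv⟩ := by
      change (Movie.nil D).component (0, r (t, v)) _ = _
      simp only [r_eq]
    rw [contains_iff κ htv, contains_iff (φ κ) ⟨rfl, hv⟩, ← φ_component, φ.apply_eq_iff_eq]
  refine ⟨φ, fun κ v hv => φ_contains κ 0 v hv (M.isPoint_source hv) (r_source v hv),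
    fun κ v hv => φ_contains κ M.length v hv (M.isPoint_target hv) (r_target v hv), fun κ => ?_⟩
  rw [weight_eq_zero]
  rfl

end Movie

section Snake

variable {m i : ℕ} {h : i ≤ m}

theorem isPoint_cap_iff {v : ℕ × ℕ} :
    (cap m i h).IsPoint v ↔ (v.1 = 0 ∧ v.2 < m + 2) ∨ (v.1 = 1 ∧ v.2 < m) := by
  constructor
  · rintro (hv | ⟨w, ⟨h₁, h₂⟩, rfl⟩)
    · exact .inl hv
    · exact .inr ⟨congrArg (· + 1) h₁, h₂⟩
  · rintro (hv | ⟨h₁, h₂⟩)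
    · exact .inl hv
    · exact .inr ⟨(0, v.2), ⟨rfl, h₂⟩, Prod.ext h₁ rfl⟩

theorem isPoint_cap_comp_circ_iff {v : ℕ × ℕ} : ((cap m i h).comp (circ m i h)).IsPoint v ↔
    (v.1 % 2 = 0 ∧ v.1 < 4 ∧ v.2 < m + 2) ∨ (v.1 % 2 = 1 ∧ v.1 < 4 ∧ v.2 < m) := by
  obtain ⟨l, x⟩ := v
  rcases l with _ | _ | _ | _ | l <;> simp [cap, cup, circ, IsPoint]

/-- The projection of the levels of a cap followed by a small circle onto those of the cap, which
folds the circle onto the arc of the cap. -/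
def foldLevel (v : ℕ × ℕ) : ℕ × ℕ := (v.1 % 2, v.2)

theorem foldLevel_of_isPoint_cap {v : ℕ × ℕ} (hv : (cap m i h).IsPoint v) : foldLevel v = v := by
  obtain ⟨h₁, _⟩ | ⟨h₁, _⟩ := isPoint_cap_iff.1 hv <;> exact Prod.ext (by rw [foldLevel, h₁]) rfl

theorem edge_foldLevel_of_cap {v w : ℕ × ℕ} (e : (Piece.cap m i h).Edge v w) :
    (cap m i h).Edge (foldLevel v) (foldLevel w) := by
  cases e with
  | cap_left x hx => exact .inl (.cap_left x hx)
  | cap_right x hx => exact .inl (.cap_right x hx)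
  | cap_arc => exact .inl .cap_arc

theorem edge_foldLevel_of_cup {v w : ℕ × ℕ} (e : (Piece.cup m i h).Edge v w) :
    (cap m i h).Edge (foldLevel (v.1 + 1, v.2)) (foldLevel (w.1 + 1, w.2)) ∨
      (cap m i h).Edge (foldLevel (w.1 + 1, w.2)) (foldLevel (v.1 + 1, v.2)) := by
  cases e <;> simp only [foldLevel, Nat.reduceAdd, Nat.reduceMod]
  case cup_left x hx _ => exact .inr (.inl (.cap_left x hx))
  case cup_right x hx _ => exact .inr (.inl (.cap_right x hx))
  case cup_arc => exact .inl (.inl .cap_arc)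

theorem foldLevel_add_two (v : ℕ × ℕ) : foldLevel (v.1 + 1 + 1, v.2) = foldLevel v :=
  Prod.ext (Nat.add_mod_right v.1 2) rfl

theorem edge_foldLevel_of_cap_comp_circ {v w : ℕ × ℕ}
    (e : ((cap m i h).comp (circ m i h)).Edge v w) :
    (cap m i h).Edge (foldLevel v) (foldLevel w) ∨
      (cap m i h).Edge (foldLevel w) (foldLevel v) := by
  rcases e with e | ⟨v, w, e | ⟨v', w', e | ⟨_, _, e, _⟩, rfl, rfl⟩, rfl, rfl⟩
  · exact .inl (edge_foldLevel_of_cap e)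
  · exact edge_foldLevel_of_cup e
  · rw [foldLevel_add_two, foldLevel_add_two]
    exact .inl (edge_foldLevel_of_cap e)
  · exact e.elim

variable (m i h) in
/-- The movie in which a circle splits off a cap and dies. -/
def snake : Movie (cap m i h) (cap m i h) :=
  Movie.comp (E := (cap m i h).comp (circ m i h))
    ((Elem.saddle m i h).toMove.movie.right (cap m i h)) ((death m i h).left (cap m i h))

theorem isPoint_snake_iff {p : ℕ × ℕ × ℕ} : (snake m i h).IsPoint p ↔
    (p.1 = 0 ∧ (cap m i h).IsPoint p.2) ∨
    (p.1 = 1 ∧ ((cap m i h).comp (circ m i h)).IsPoint p.2) ∨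
      (p.1 = 2 ∧ (cap m i h).IsPoint p.2) := by
  constructor
  · rintro (hp | ⟨q, ⟨h₁, h₂⟩ | ⟨r, ⟨h₁, h₂⟩, rfl⟩, rfl⟩)
    · exact .inl hp
    · exact .inr (.inl ⟨congrArg (· + 1) h₁, h₂⟩)
    · exact .inr (.inr ⟨congrArg (· + 1 + 1) h₁, h₂⟩)
  · obtain ⟨t, v⟩ := p
    rintro (hp | ⟨rfl, hp⟩ | ⟨rfl, hp⟩)
    · exact .inl hp
    · exact .inr ⟨(0, v), .inl ⟨rfl, hp⟩, rfl⟩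
    · exact .inr ⟨(1, v), .inr ⟨(0, v), ⟨rfl, hp⟩, rfl⟩, rfl⟩

theorem isPoint_foldLevel_of_isPoint_snake (p : ℕ × ℕ × ℕ) (hp : (snake m i h).IsPoint p) :
    (cap m i h).IsPoint (foldLevel p.2) := by
  obtain ⟨_, hv⟩ | ⟨_, hv⟩ | ⟨_, hv⟩ := isPoint_snake_iff.1 hp
  · rwa [foldLevel_of_isPoint_cap hv]
  · obtain ⟨hl, _, hx⟩ | ⟨hl, _, hx⟩ := isPoint_cap_comp_circ_iff.1 hv
    · exact isPoint_cap_iff.2 (.inl ⟨hl, hx⟩)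
    · exact isPoint_cap_iff.2 (.inr ⟨hl, hx⟩)
  · rwa [foldLevel_of_isPoint_cap hv]

theorem edge_foldLevel_of_edge_snake (p q : ℕ × ℕ × ℕ) (hpq : (snake m i h).Edge p q) :
    foldLevel p.2 = foldLevel q.2 ∨ (cap m i h).Edge (foldLevel p.2) (foldLevel q.2) ∨
      (cap m i h).Edge (foldLevel q.2) (foldLevel p.2) := by
  have cap_edge {v w : ℕ × ℕ} (e : (cap m i h).Edge v w) :
      (cap m i h).Edge (foldLevel v) (foldLevel w) := by
    obtain e | ⟨_, _, e, _⟩ := e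
    exacts [edge_foldLevel_of_cap e, e.elim]
  rcases hpq with ⟨_, _, e⟩ | ⟨_, _, hx, ⟨hl, _⟩ | ⟨k, hp, hq⟩⟩ | ⟨p, q, ⟨_, _, e⟩ |
    ⟨_, _, hx, ⟨hl, _⟩ | ⟨k, hp, hq⟩⟩ | ⟨_, _, ⟨_, _, e⟩, rfl, rfl⟩, rfl, rfl⟩
  · exact .inr (.inl (cap_edge e))
  · exact .inl (congrArg foldLevel (Prod.ext hl hx))
  · have hp : p.2.1 = 0 + 0 + k := hp
    have hq : q.2.1 = 0 + 2 + k := hq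
    exact .inl (Prod.ext (by simp only [foldLevel]; omega) hx)
  · exact .inr (edge_foldLevel_of_cap_comp_circ e)
  · exact .inl (congrArg foldLevel (Prod.ext hl hx))
  · have hp : p.2.1 = 1 + 2 + k := hp
    have hq : q.2.1 = 1 + 0 + k := hq
    exact .inl (Prod.ext (by simp only [foldLevel]; omega) hx)
  · exact .inr (.inl (cap_edge e))

theorem component_snake_one {v : ℕ × ℕ} (hv : ((cap m i h).comp (circ m i h)).IsPoint v)
    (hv₀ : (cap m i h).IsPoint (foldLevel v)) :
    (snake m i h).component (0, foldLevel v) (isPoint_snake_iff.2 (.inl ⟨rfl, hv₀⟩)) =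
      (snake m i h).component (1, v) (isPoint_snake_iff.2 (.inr (.inl ⟨rfl, hv⟩))) := by
  have hv' := isPoint_cap_comp_circ_iff.1 hv
  by_cases hl : v.1 = 1
  · obtain ⟨l, x⟩ := v
    obtain rfl : l = 1 := hl
    have hx : x < m := by simpa using hv'
    obtain ⟨y, hy, e⟩ : ∃ y < m + 2, (Piece.cap m i h).Edge (0, y) (1, x) := by
      obtain hi | hi := lt_or_ge x i
      exacts [⟨x, by omega, .cap_left x hi⟩, ⟨x + 2, by omega, .cap_right x hi⟩]
    have hy₀ : (snake m i h).IsPoint (0, 0, y) :=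
      isPoint_snake_iff.2 (.inl ⟨rfl, isPoint_cap_iff.2 (.inl ⟨rfl, hy⟩)⟩)
    have hy₁ : (snake m i h).IsPoint (1, 0, y) :=
      isPoint_snake_iff.2 (.inr (.inl ⟨rfl, .inl ⟨rfl, hy⟩⟩))
    have strand_zero : (snake m i h).Edge (0, 0, y) (0, 1, x) := .inl ⟨rfl, rfl, .inl e⟩
    have strand_one : (snake m i h).Edge (1, 0, y) (1, 1, x) :=
      .inr (.inr ⟨(0, 0, y), (0, 1, x), .inl ⟨rfl, rfl, .inl e⟩, rfl, rfl⟩)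
    calc _ = (snake m i h).component (0, 0, y) hy₀ :=
          (Movie.component_eq_of_edge _ _ strand_zero).symm
      _ = (snake m i h).component (1, 0, y) hy₁ :=
          Movie.component_eq_of_edge _ _ (.inr (.inl ⟨rfl, rfl, rfl, .inl ⟨rfl, le_rfl⟩⟩))
      _ = _ := Movie.component_eq_of_edge _ _ strand_one
  · refine Movie.component_eq_of_edge _ _ (.inr (.inl ⟨rfl, rfl, rfl, ?_⟩))
    change (v.1 % 2 = v.1 ∧ v.1 % 2 ≤ 0) ∨ ∃ k, v.1 % 2 = 0 + 0 + k ∧ v.1 = 0 + 2 + k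
    obtain hl' | hl' : v.1 = 0 ∨ v.1 = v.1 % 2 + 2 := by omega
    · exact .inl (by omega)
    · exact .inr ⟨v.1 % 2, by omega⟩

theorem component_foldLevel (p : ℕ × ℕ × ℕ) (hp : (snake m i h).IsPoint p) :
    (snake m i h).component (0, foldLevel p.2)
      ((snake m i h).isPoint_source (isPoint_foldLevel_of_isPoint_snake p hp)) =
      (snake m i h).component p hp := by
  obtain ⟨t, v⟩ := p
  have hv₀ := isPoint_foldLevel_of_isPoint_snake _ hp
  obtain ⟨rfl, hv⟩ | ⟨rfl, hv⟩ | ⟨rfl, hv⟩ : (t = 0 ∧ _) ∨ (t = 1 ∧ _) ∨ (t = 2 ∧ _) :=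
    isPoint_snake_iff.1 hp
  · simp only [foldLevel_of_isPoint_cap hv]
  · exact component_snake_one hv hv₀
  · have cap_level_le : v.1 ≤ 1 := by
      obtain ⟨hl, _⟩ | ⟨hl, _⟩ := isPoint_cap_iff.1 hv
      exacts [hl.trans_le zero_le_one, hl.le]
    have hv₁ : ((cap m i h).comp (circ m i h)).IsPoint v := by
      rw [isPoint_cap_comp_circ_iff]
      have : v.1 = 0 ∧ v.2 < m + 2 ∨ v.1 = 1 ∧ v.2 < m := isPoint_cap_iff.1 hv
      omega
    have death_sheet : (snake m i h).Edge (1, v) (2, v) :=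
      .inr (.inr ⟨(0, v), (1, v), .inr (.inl ⟨rfl, rfl, rfl, .inl ⟨rfl, cap_level_le⟩⟩), rfl, rfl⟩)
    exact (component_snake_one hv₁ hv₀).trans (Movie.component_eq_of_edge _ hp death_sheet)

theorem weight_snake (κ : (snake m i h).Component) : κ.weight = 0 := by
  classical
  have marks_snake : (snake m i h).marks = [((0, 0, i), (-1, 0)), ((1, 2, i), (1, 0))] := rfl
  have hi : i < m + 2 := by omega
  have hp : (snake m i h).IsPoint (0, 0, i) :=
    isPoint_snake_iff.2 (.inl ⟨rfl, isPoint_cap_iff.2 (.inl ⟨rfl, hi⟩)⟩)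
  have hq : (snake m i h).IsPoint (1, 2, i) :=
    isPoint_snake_iff.2 (.inr (.inl ⟨rfl, isPoint_cap_comp_circ_iff.2 (.inl (by simpa using hi))⟩))
  have saddle_sheet : (snake m i h).Edge (0, 0, i) (1, 2, i) :=
    .inr (.inl ⟨rfl, rfl, rfl, .inr ⟨0, rfl, rfl⟩⟩)
  have contains_iff_contains : κ.Contains (0, 0, i) ↔ κ.Contains (1, 2, i) := by
    rw [Movie.contains_iff κ hp, Movie.contains_iff κ hq,
      Movie.component_eq_of_edge hp hq saddle_sheet]
  rw [Movie.Component.weight, marks_snake]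
  by_cases hκ : κ.Contains (1, 2, i) <;> simp [List.filter, contains_iff_contains, hκ]

theorem snake_homeomorphic : (snake m i h).Homeomorphic (.nil (cap m i h)) :=
  (snake m i h).homeomorphic_nil_of_retraction (fun p => foldLevel p.2)
    isPoint_foldLevel_of_isPoint_snake edge_foldLevel_of_edge_snake component_foldLevel
    (fun _ => foldLevel_of_isPoint_cap) (fun _ => foldLevel_of_isPoint_cap) weight_snake

theorem cls_snake : cls (snake m i h) = cls (.nil (cap m i h)) :=
  cls_eq_cls_of_relator (.homeo _ _ snake_homeomorphic)

end Snake

section Uniqueness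

/-- The saddles `A ⟶ q e ⊗ A`, for a turnback `e`. -/
def saddle (m i : ℕ) (h : i ≤ m) :
    𝟭 (Cob (m + 2)) ⟶ stackLeft (turnback m i h) ⋙ qShift (m + 2) 1 :=
  stackLeftNatTrans (cls_mem_homogeneous (Elem.saddle m i h).toMove.movie)

/-- The map `q e ⊗ A ⟶ A` in which the circle formed by the turnback `e` and the lowest piece of
`A`, the same cap as that of `e`, dies. -/
def capDeath {m i : ℕ} (h : i ≤ m) (V : Diag m (m + 2)) (q : ℤ) :
    (qShift (m + 2) 1).obj ((stackLeft (turnback m i h)).obj ⟨(cap m i h).comp V, q⟩) ⟶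
      (⟨(cap m i h).comp V, q⟩ : Cob (m + 2)) :=
  ⟨cls (((death m i h).left (cap m i h)).right V), by
    change _ ∈ homogeneous _ _ (q + 1 - q)
    rw [add_sub_cancel_left]
    exact cls_mem_homogeneous (((death m i h).left (cap m i h)).right V)⟩

theorem saddle_app_capDeath {m i : ℕ} (h : i ≤ m) (V : Diag m (m + 2)) (q : ℤ) :
    (saddle m i h).app ⟨(cap m i h).comp V, q⟩ ≫ capDeath h V q = 𝟙 _ := by
  let s := (Elem.saddle m i h).toMove.movie
  let t := (death m i h).left (cap m i h)
  have comp_eq_snake : cobComp _ _ _ (cobRight _ _ ((cap m i h).comp V) (cls s)) (cls (t.right V)) =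
      cls ((snake m i h).right V) :=
    (congrArg (cobComp _ _ _ · _) (cobRight_cls s _)).trans (cobComp_cls _ _)
  refine Subtype.ext (comp_eq_snake.trans ?_)
  calc cls ((snake m i h).right V)
      = cobRight _ _ V (cls (snake m i h)) := (cobRight_cls _ V).symm
    _ = cobRight _ _ V (cls (.nil (cap m i h))) := congrArg (cobRight _ _ V) cls_snake
    _ = cls (.nil ((cap m i h).comp V)) := cobRight_cls _ V

variable {n : ℕ} {K : CochainComplex (MatCob n) ℤ}

theorem IsContractible.nonempty_homotopy (hK : IsContractible K) : Nonempty (Homotopy (𝟙 K) 0) := by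
  obtain ⟨e⟩ := hK
  have null : e.hom ≫ e.inv = 0 := by rw [(isZero_zero _).eq_of_tgt e.hom 0, zero_comp]
  exact ⟨e.homotopyHomInvId.symm.trans (Homotopy.ofEq null)⟩

theorem homExact_of_startsWithCap
    (hK : ∀ (i : ℕ) (h₀ : 0 < i) (h₁ : i < n), IsContractible (tensorLeft (gen n i h₀ h₁) K))
    {D : Diag n n} (hD : StartsWithCap D) (q : ℤ) :
    HomExact K ((Mat_.embedding (Cob n)).obj ⟨D, q⟩) := by
  cases hD with
  | @cons m i _ h V =>
    obtain ⟨s⟩ := (hK (i + 1) (Nat.succ_pos i) (by omega)).nonempty_homotopy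
    refine .of_natTrans (F := (stackLeft (turnback m i h)).mapMat_)
      (G := (qShift (m + 2) 1).mapMat_) (mapMatNatTrans (F := 𝟭 _) (saddle m i h))
      ((Mat_.embedding _).map (capDeath h V q)) ?_ (.of_homotopy s _)
    calc _ = (Mat_.embedding _).map ((saddle m i h).app _) ≫
            (Mat_.embedding _).map (capDeath h V q) :=
          congrArg (· ≫ _) (mapMatNatTrans_app_embedding (F := 𝟭 _) (saddle m i h) _)
      _ = (Mat_.embedding _).map (𝟙 _) := by rw [← Functor.map_comp, saddle_app_capDeath]
      _ = 𝟙 _ := (Mat_.embedding _).map_id _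

theorem exists_iso_unit_biprod (Z : MatCob n) (s : Z.ι) (S : Splitting (Z.X s).diag (.nil n)) :
    ∃ (j : ℤ) (D : MatCob n), Nonempty (Z ≅ unit n j ⊞ D) := by
  obtain ⟨k⟩ := S.nonempty
  exact ⟨_, _, ⟨Z.isoBiproductEmbedding ≪≫ biproductIsoBiprod _ s ≪≫
    biprod.mapIso (S.isoBiproduct _ ≪≫ biproductIsoBiprod _ k) (Iso.refl _) ≪≫
      biprod.associator _ _ _⟩⟩

theorem homExact_of_isEmpty_iso
    (hK : ∀ (i : ℕ) (h₀ : 0 < i) (h₁ : i < n), IsContractible (tensorLeft (gen n i h₀ h₁) K))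
    {Z : MatCob n} (hZ : ∀ (j : ℤ) (D : MatCob n), IsEmpty (Z ≅ unit n j ⊞ D)) :
    HomExact K Z := by
  refine .of_retract (.biproduct fun s => ?_) (.ofIso Z.isoBiproductEmbedding)
  obtain ⟨W, -, ⟨S⟩, hcups | hcap⟩ := exists_splitting_isCups_or_startsWithCap (Z.X s).diag
  · obtain rfl := hcups.eq_nil
    obtain ⟨j, D, ⟨e⟩⟩ := exists_iso_unit_biprod Z s S
    exact ((hZ j D).false e).elim
  · exact .of_retract (.biproduct fun _ => homExact_of_startsWithCap hK hcap _)
      (.ofIso (S.isoBiproduct _))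

end Uniqueness

end BarNatan

end

theorem corollary3p5_general {n : ℕ} {K L : CochainComplex (BarNatan.MatCob n) ℤ}
    (hK : ∀ k < 0, IsZero (K.X k)) (hL : ∀ k < 0, IsZero (L.X k))
    (hK_unit : ∀ k > 0, ∀ (j : ℤ) (Z : BarNatan.MatCob n),
      IsEmpty (K.X k ≅ BarNatan.unit n j ⊞ Z))
    (hL_unit : ∀ k > 0, ∀ (j : ℤ) (Z : BarNatan.MatCob n),
      IsEmpty (L.X k ≅ BarNatan.unit n j ⊞ Z))
    (hK_gen : ∀ (i : ℕ) (h₀ : 0 < i) (h₁ : i < n),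
      BarNatan.IsContractible (BarNatan.tensorLeft (BarNatan.gen n i h₀ h₁) K))
    (hL_gen : ∀ (i : ℕ) (h₀ : 0 < i) (h₁ : i < n),
      BarNatan.IsContractible (BarNatan.tensorLeft (BarNatan.gen n i h₀ h₁) L))
    (e : K.X 0 ≅ L.X 0) : Nonempty (HomotopyEquiv K L) :=
  BarNatan.nonempty_homotopyEquiv hK hL
    (fun k hk => BarNatan.homExact_of_isEmpty_iso hK_gen (hK_unit k hk))
    (fun k hk => BarNatan.homExact_of_isEmpty_iso hK_gen (hL_unit k hk))
    (fun k hk => BarNatan.homExact_of_isEmpty_iso hL_gen (hK_unit k hk))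
    (fun k hk => BarNatan.homExact_of_isEmpty_iso hL_gen (hL_unit k hk)) e

theorem corollary3p5 (n : ℕ) (C D : BarNatan.Kom n)
    (hC : BarNatan.IsUniversalProjector C) (hD : BarNatan.IsUniversalProjector D) :
    Nonempty (HomotopyEquiv C.obj D.obj) := by
  obtain ⟨e⟩ := hC.zero_iso
  obtain ⟨e'⟩ := hD.zero_iso
  exact corollary3p5_general hC.isZero_of_neg hD.isZero_of_neg hC.not_iso hD.not_iso
    hC.left_contractible hD.left_contractible (e ≪≫ e'.symm)
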